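/- Let $\mu,\nu$ be Borel probability measures on $[0,1]$ with $\mu$ atomless, $\operatorname{supp}\nu\subseteq\operatorname{supp}\mu$ and $\nu(\{0,1\})=0$, and let $F_\mu(x)=\mu([0,x])$. Let $C_{\nu,\mu}$ be the space of continuous functions $f:[0,1]\to\mathbb{R}$, with the supremum norm, such that on each connected component $J$ of $[0,1]\setminus\operatorname{supp}\nu$ one has $f=a_JF_\mu+b_J$ with constants $a_J,b_J\in\mathbb{R}$. Let $\gamma=(\alpha,\beta)\in[0,\pi/2]^2$, and let $C^\gamma_{\nu,\mu}$ be the subspace of those $f\in C_{\nu,\mu}$ with $f(0)=0$ if $\alpha=0$, and $f(1)=0$ if $\beta=0$. Assume that $\min\operatorname{supp}\nu=\min\operatorname{supp}\mu$ if $\alpha\neq0$, and that $\max\operatorname{supp}\nu=\max\operatorname{supp}\mu$ if $\beta\neq0$. A continuous function $f$ on $[0,1]$ belongs to $\mathcal{D}^s_\gamma(\Delta_{\nu,\mu})$, with $\Delta_{\nu,\mu}f=g$, if there are $a,b\in\mathbb{R}$ and $g\in C_{\nu,\mu}$ with $$f(x)=a+bF_\mu(x)+\int_{[0,x]}(F_\mu(x)-F_\mu(y))\,g(y)\,d\nu(y)\qquad(x\in[0,1])$$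 and if, with $\nabla_\mu f(x)=b+\int_{[0,x]}g\,d\nu$, the Robin boundary conditions $$f(0)\cos\alpha-\nabla_\mu f(0)\sin\alpha=0,\qquad f(1)\cos\beta+\nabla_\mu f(1)\sin\beta=0$$ hold. Then $\Delta_{\nu,\mu}$ with domain $\mathcal{D}^s_\gamma(\Delta_{\nu,\mu})$, considered as an operator in $C^\gamma_{\nu,\mu}$, is a well-defined linear operator and is the infinitesimal generator of a strongly continuous semigroup of contractions on $C^\gamma_{\nu,\mu}$. Precisely: the set of pairs $(f,g)\in C^\gamma_{\nu,\mu}\times C^\gamma_{\nu,\mu}$ with $f\in\mathcal{D}^s_\gamma(\Delta_{\nu,\mu})$ and $\Delta_{\nu,\mu}f=g$ is the graph of a linear operator, and this operator is such a generator. (If $\alpha,\beta>0$, then $C^\gamma_{\nu,\mu}=C_{\nu,\mu}$ and the domain of this operator is all of $\mathcal{D}^s_\gamma(\Delta_{\nu,\mu})$; if $\alpha=0$ or $\beta=0$, its domain consists of those $f\in\mathcal{D}^s_\gamma(\Delta_{\nu,\mu})$ with $\Delta_{\nu,\mu}f\in C^\gamma_{\nu,\mu}$.) -/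

import Mathlib

open MeasureTheory Filter Topology Set
open scoped NNReal unitInterval

noncomputable section

namespace KreinFeller

/-- The distribution function `F_μ(x) = μ([0,x])` of a measure on `[0,1]`. -/
def F (μ : Measure I) (x : I) : ℝ := μ.real (Iic x)

/-- The space `C_{ν,μ}`: continuous functions on `[0,1]` that are affine in `F_μ` on every
connected component of `[0,1] \ supp ν`. With the norm of `C(I, ℝ)` it carries the sup norm. -/
def CSpace (μ ν : Measure I) : Submodule ℝ C(I, ℝ) where
  carrier := {f | ∀ x ∈ ν.supportᶜ, ∃ a b : ℝ,
    ∀ y ∈ connectedComponentIn ν.supportᶜ x, f y = a * F μ y + b}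
  zero_mem' := fun _ _ => ⟨0, 0, fun _ _ => by simp⟩
  add_mem' := by
    intro f g hf hg x hx
    obtain ⟨a, b, h⟩ := hf x hx
    obtain ⟨c, d, h'⟩ := hg x hx
    exact ⟨a + c, b + d, fun y hy => by
      rw [ContinuousMap.add_apply, h y hy, h' y hy]; ring⟩
  smul_mem' := by
    intro r f hf x hx
    obtain ⟨a, b, h⟩ := hf x hx
    exact ⟨r * a, r * b, fun y hy => by
      rw [ContinuousMap.smul_apply, h y hy, smul_eq_mul]; ring⟩

/-- The space `C^γ_{ν,μ}`, `γ = (α, β)`: the functions in `C_{ν,μ}` that vanish at `0` if `α = 0`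
and at `1` if `β = 0`. -/
def CGamma (μ ν : Measure I) (α β : ℝ) : Submodule ℝ C(I, ℝ) where
  carrier := {f | f ∈ CSpace μ ν ∧ (α = 0 → f 0 = 0) ∧ (β = 0 → f 1 = 0)}
  zero_mem' := ⟨zero_mem _, fun _ => rfl, fun _ => rfl⟩
  add_mem' := by
    rintro f g ⟨hf, hf0, hf1⟩ ⟨hg, hg0, hg1⟩
    exact ⟨add_mem hf hg, fun h => by simp [hf0 h, hg0 h], fun h => by simp [hf1 h, hg1 h]⟩
  smul_mem' := by
    rintro r f ⟨hf, hf0, hf1⟩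
    exact ⟨Submodule.smul_mem _ r hf, fun h => by simp [hf0 h], fun h => by simp [hf1 h]⟩

/-- `f(x) = a + b F_μ(x) + ∫_{[0,x]} (F_μ(x) - F_μ(y)) g(y) dν(y)` for all `x ∈ [0,1]`. -/
def Represents (μ ν : Measure I) (f g : C(I, ℝ)) (a b : ℝ) : Prop :=
  ∀ x : I, f x = a + b * F μ x + ∫ y in Iic x, (F μ x - F μ y) * g y ∂ν

/-- The number `b` in the representation is the derivative
`∇_μ f(0) = lim_{x ↓ p} (f(x) - f(0)) / (F_μ(x) - F_μ(0))`, `p = min (supp μ)`,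
provided that `ν` has no atom at `p`. -/
theorem Represents.tendsto_nabla_zero {μ ν : Measure I} [IsProbabilityMeasure μ]
    [IsProbabilityMeasure ν] [NullSingletonClass μ] (hsupp : ν.support ⊆ μ.support)
    {f g : C(I, ℝ)} {a b : ℝ} (h : Represents μ ν f g a b) {p : I} (hp : IsLeast μ.support p)
    (hνp : ν {p} = 0) :
    Tendsto (fun x => (f x - f 0) / (F μ x - F μ 0)) (𝓝[>] p) (𝓝 b) := by
  have hIic0 : Iic (0 : I) = {0} := by
    ext x
    exact ⟨fun hx => le_antisymm hx unitInterval.nonneg', fun hx => hx.le⟩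
  have hF0 : F μ 0 = 0 := by simp [F, hIic0, measureReal_def]
  have hf0 : f 0 = a := by
    have := h 0
    rw [hF0, hIic0] at this
    rw [this]
    have h2 : ∫ y in {(0 : I)}, (0 - F μ y) * g y ∂ν = 0 := by
      rw [setIntegral_congr_fun (g := fun _ => (0 : ℝ)) (measurableSet_singleton _)]
      · simp
      · intro y hy; rw [mem_singleton_iff.1 hy]; simp [hF0]
    rw [h2]; ring
  have hmono : Monotone (F μ) := fun x y hxy => measureReal_mono (Iic_subset_Iic.2 hxy)
  have hFnn : ∀ x, 0 ≤ F μ x := fun x => measureReal_nonneg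
  have hFpos : ∀ x, p < x → 0 < F μ x := by
    intro x hx
    have := (Measure.mem_support_iff_forall p).1 hp.1 (Iic x) (Iic_mem_nhds hx)
    exact ENNReal.toReal_pos this.ne' (measure_ne_top _ _)
  have hνIic : ν (Iic p) = 0 := by
    have h1 : Iic p ⊆ {p} ∪ ν.supportᶜ := by
      intro y hy
      by_cases hyp : y = p
      · exact Or.inl hyp
      · exact Or.inr fun hys => hyp (le_antisymm hy (hp.2 (hsupp hys)))
    exact measure_mono_null h1 (measure_union_null hνp Measure.measure_compl_support)
  have hlim : Tendsto (fun x => ν.real (Iic x)) (𝓝[>] p) (𝓝 0) := by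
    rcases (show p ≤ 1 from unitInterval.le_one').eq_or_lt with hp1 | hp1
    · have hemp : Ioi p = ∅ := by
        ext x
        simpa [hp1] using (unitInterval.le_one' : x ≤ 1)
      simp [hemp]
    have h1 : Tendsto (fun x => ν (Iic x)) (𝓝[>] p) (𝓝 (ν (⋂ r > p, Iic r))) :=
      tendsto_measure_biInter_gt (fun r _ => measurableSet_Iic.nullMeasurableSet)
        (fun i j _ hij => Iic_subset_Iic.2 hij) ⟨1, hp1, measure_ne_top _ _⟩
    have h2 : (⋂ r > p, Iic r) = Iic p := by
      ext y
      simp only [mem_iInter, mem_Iic]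
      exact ⟨fun hy => le_of_forall_gt_imp_ge_of_dense hy, fun hy r hr => hy.trans hr.le⟩
    rw [h2, hνIic] at h1
    simpa [measureReal_def, Function.comp_def] using (ENNReal.tendsto_toReal ENNReal.zero_ne_top).comp h1
  have hbd : ∀ᶠ x in 𝓝[>] p,
      |(f x - f 0) / (F μ x - F μ 0) - b| ≤ ‖g‖ * ν.real (Iic x) := by
    filter_upwards [self_mem_nhdsWithin] with x hx
    have hx' := hFpos x hx
    have e : (f x - f 0) / (F μ x - F μ 0) - b
        = (∫ y in Iic x, (F μ x - F μ y) * g y ∂ν) / F μ x := by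
      rw [hF0, hf0, h x, eq_div_iff hx'.ne', sub_mul, sub_zero, div_mul_cancel₀ _ hx'.ne']
      ring
    rw [e, abs_div, abs_of_pos hx', div_le_iff₀ hx', ← Real.norm_eq_abs]
    have := norm_setIntegral_le_of_norm_le_const (μ := ν) (s := Iic x) (C := F μ x * ‖g‖)
      (f := fun y => (F μ x - F μ y) * g y) (measure_lt_top _ _) (fun y hy => by
        rw [norm_mul, Real.norm_eq_abs, abs_of_nonneg (sub_nonneg.2 (hmono hy))]
        exact mul_le_mul (by linarith [hFnn y]) (g.norm_coe_le_norm y) (norm_nonneg _) hx'.le)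
    linarith
  rw [tendsto_iff_norm_sub_tendsto_zero]
  refine squeeze_zero' (Eventually.of_forall fun _ => norm_nonneg _) hbd ?_
  simpa using hlim.const_mul ‖g‖

/-- The first derivative `∇_μ f(x) = b + ∫_{[0,x]} g dν`, where `b = ∇_μ f(0)` and
`g = Δ_{ν,μ} f`. -/
def nabla (ν : Measure I) (g : C(I, ℝ)) (b : ℝ) (x : I) : ℝ := b + ∫ y in Iic x, g y ∂ν

/-- `f` lies in the strong domain `D^s_γ(Δ_{ν,μ})`, `γ = (α, β)`, and `Δ_{ν,μ} f = g`: the function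
`f` is represented by `a`, `b = ∇_μ f(0)` and `g ∈ C_{ν,μ}`, and it satisfies the Robin boundary
conditions. -/
def StrongOp (μ ν : Measure I) (α β : ℝ) (f g : C(I, ℝ)) : Prop :=
  g ∈ CSpace μ ν ∧ ∃ a b : ℝ, Represents μ ν f g a b ∧
    f 0 * Real.cos α - nabla ν g b 0 * Real.sin α = 0 ∧
    f 1 * Real.cos β + nabla ν g b 1 * Real.sin β = 0

/-- A strongly continuous semigroup of contractions on a normed space. -/
structure IsContractionSemigroup {E : Type*} [NormedAddCommGroup E] [NormedSpace ℝ E]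
    (T : ℝ≥0 → E →L[ℝ] E) : Prop where
  map_zero : T 0 = ContinuousLinearMap.id ℝ E
  map_add : ∀ s t, T (s + t) = (T s).comp (T t)
  norm_le_one : ∀ t, ‖T t‖ ≤ 1
  continuous_orbit : ∀ x, Continuous fun t => T t x

/-- `A` is the infinitesimal generator of `T`: its domain consists exactly of the `x` for which
`lim_{t ↓ 0} (T_t x - x) / t` exists, and `A x` is that limit. -/
def IsGenerator {E : Type*} [NormedAddCommGroup E] [NormedSpace ℝ E]
    (T : ℝ≥0 → E →L[ℝ] E) (A : E →ₗ.[ℝ] E) : Prop :=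
  ∀ x y : E, (x, y) ∈ A.graph ↔
    Tendsto (fun t : ℝ≥0 => (t : ℝ)⁻¹ • (T t x - x)) (𝓝[>] 0) (𝓝 y)

end KreinFeller

end

/-!
The operator `Δ_{ν,μ}` on `C^γ_{ν,μ}` generates a contraction semigroup by the Lumer–Phillips
theorem, which is proved here for linear relations on real Banach spaces, by Yosida approximation
(`IsDissipative.exists_semigroup`). Working with relations makes single-valuedness of `Δ_{ν,μ}` a
consequence of dissipativity and density (`IsDissipative.eq_zero_of_zero_mem`), so that uniqueness
of the derivative `g` need not be discussed separately. The theorem has three hypotheses.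

Dissipativity (`isDissipative_laplaceGraph`). With `h = ∇_μ f`, a function in the domain satisfies
the Taylor formula `f x = f x₀ + h x₀ (F x - F x₀) + ∫ ρ g dν` with a nonnegative remainder kernel
`ρ` (`Represents.taylor`). If `f` exceeds `M = ‖l f - g‖ / l` somewhere, then `g > 0` on
`{f > M}`. At a maximum point `x₀` of `f`, the formula together with the boundary conditions gives
`h x₀ ≤ 0` from the right and `h x₀ ≥ 0` from the left, and `h x₀ = 0` would force `ν = 0`
(`Represents.mul_apply_le`).

Range (`hasFullRange_laplaceGraph`). The equation `f / 2 - Δ_{ν,μ} f = k` is a Volterra equation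
with an integral operator of norm at most `1 / 2`; its solutions that satisfy the condition at `0`
depend affinely on one real parameter, which is determined by the condition at `1`.

Density (`dense_domain_laplaceGraph`). Let `L` be a continuous functional on `C([0,1])` that
annihilates the domain. Writing `f = a + b F_μ + ∫ K_y g(y) dν(y)` with the functions
`K_y = (F_μ - F_μ(y))⁺`, one sees that, up to a Lagrange multiplier for the boundary condition,
`y ↦ L K_y` is orthogonal in `L²(ν)` to all `g` in `C^γ_{ν,μ}`. As this function can be approximated
on `supp ν` by such `g` (`exists_spline_approx`), it vanishes on `supp ν`
(`eq_zero_on_support_of_orthogonal`). Hence `L` is known on `1`, `F_μ` and the `K_y` with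
`y ∈ supp ν`, whose span is dense in `C_{ν,μ}`, and there it is a combination of evaluations at end
points at which the elements of `C^γ_{ν,μ}` vanish (`dual_eq_zero_of_strongOp`).
-/

namespace KreinFeller

/-! ### Dissipative relations and their resolvents -/

section Generation

variable {E : Type*} [NormedAddCommGroup E] [NormedSpace ℝ E]

/-- A linear relation `G ⊆ E × E`, thought of as the graph of a possibly multivalued operator `A`,
is dissipative if `l ‖x‖ ≤ ‖l x - A x‖` for all `l > 0`. -/
def IsDissipative (G : Submodule ℝ (E × E)) : Prop :=
  ∀ p ∈ G, ∀ l : ℝ, 0 < l → l * ‖p.1‖ ≤ ‖l • p.1 - p.2‖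

/-- The range of `l - A` is the whole space, where `G` is the graph of `A`. -/
def HasFullRange (G : Submodule ℝ (E × E)) (l : ℝ) : Prop :=
  ∀ z, ∃ p ∈ G, l • p.1 - p.2 = z

/-- For `(u, v)` in the relation, dissipativity at `(u, v + l g)` gives
`‖u‖ ≤ ‖u - g - v / l‖`; with `l → ∞` and `u → g` this forces `g = 0`. -/
theorem IsDissipative.eq_zero_of_zero_mem {G : Submodule ℝ (E × E)} (hG : IsDissipative G)
    (hd : Dense (Prod.fst '' (G : Set (E × E)))) {g : E} (hg : ((0 : E), g) ∈ G) : g = 0 := by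
  have key : ∀ u ∈ Prod.fst '' (G : Set (E × E)), ‖u‖ ≤ ‖u - g‖ := by
    rintro _ ⟨⟨u, v⟩, huv, rfl⟩
    have h1 : ∀ l : ℝ, 0 < l → ‖u‖ ≤ ‖u - g - l⁻¹ • v‖ := by
      intro l hl
      have h2 := hG _ (G.add_mem huv (G.smul_mem l hg)) l hl
      have h3 : l • u - (v + l • g) = l • (u - g - l⁻¹ • v) := by
        simp only [smul_sub, smul_inv_smul₀ hl.ne']
        abel
      simp only [Prod.smul_mk, Prod.mk_add_mk, smul_zero, add_zero] at h2
      rw [h3, norm_smul, Real.norm_eq_abs, abs_of_pos hl] at h2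
      exact le_of_mul_le_mul_left h2 hl
    have h2 : Tendsto (fun l : ℝ => ‖u - g - l⁻¹ • v‖) atTop (𝓝 ‖u - g - (0 : ℝ) • v‖) :=
      ((tendsto_inv_atTop_zero.smul_const v).const_sub _).norm
    rw [zero_smul, sub_zero] at h2
    exact ge_of_tendsto h2 ((eventually_gt_atTop 0).mono h1)
  have h := hd.induction (P := fun u => ‖u‖ ≤ ‖u - g‖) key
    (isClosed_le continuous_norm (by fun_prop)) g
  simpa using h

theorem IsDissipative.ext {G : Submodule ℝ (E × E)} (hG : IsDissipative G) {l : ℝ} (hl : 0 < l)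
    {p q : E × E} (hp : p ∈ G) (hq : q ∈ G) (h : l • p.1 - p.2 = l • q.1 - q.2) : p = q := by
  have h1 := hG _ (G.sub_mem hp hq) l hl
  have h2 : l • (p - q).1 - (p - q).2 = 0 := by
    rw [Prod.fst_sub, Prod.snd_sub, smul_sub, sub_sub_sub_comm, h, sub_self]
  rw [h2, norm_zero] at h1
  have h3 : (p - q).1 = 0 := norm_eq_zero.1 (le_antisymm (by nlinarith) (norm_nonneg _))
  have h4 : (p - q).2 = 0 := by rwa [h3, smul_zero, zero_sub, neg_eq_zero] at h2
  exact sub_eq_zero.1 (Prod.ext h3 h4)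

/-- The bounded inverse of `l - A`. -/
theorem IsDissipative.exists_resolvent {G : Submodule ℝ (E × E)} (hG : IsDissipative G) {l : ℝ}
    (hl : 0 < l) (hr : HasFullRange G l) :
    ∃ R : E →L[ℝ] E, (∀ z, (R z, l • R z - z) ∈ G) ∧ ∀ z, ‖R z‖ ≤ l⁻¹ * ‖z‖ := by
  choose r hr hrz using hr
  have hadd : ∀ z w, r (z + w) = r z + r w := fun z w =>
    hG.ext hl (hr _) (G.add_mem (hr _) (hr _)) (by
      rw [hrz, Prod.fst_add, Prod.snd_add, smul_add, add_sub_add_comm, hrz, hrz])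
  have hsmul : ∀ (c : ℝ) z, r (c • z) = c • r z := fun c z =>
    hG.ext hl (hr _) (G.smul_mem c (hr _)) (by
      rw [hrz, Prod.smul_fst, Prod.smul_snd, smul_comm l c, ← smul_sub, hrz])
  have hbd : ∀ z, ‖(r z).1‖ ≤ l⁻¹ * ‖z‖ := by
    intro z
    have := hG _ (hr z) l hl
    rw [hrz] at this
    rwa [le_inv_mul_iff₀ hl]
  refine ⟨LinearMap.mkContinuous
    { toFun := fun z => (r z).1
      map_add' := fun z w => by rw [hadd, Prod.fst_add]
      map_smul' := fun c z => by rw [hsmul, Prod.smul_fst, RingHom.id_apply] } l⁻¹ hbd, ?_, hbd⟩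
  intro z
  have : (r z) = ((r z).1, l • (r z).1 - z) :=
    Prod.ext rfl (by simp only; nth_rewrite 3 [← hrz z]; abel)
  have h := hr z
  rw [this] at h
  exact h

/-- Full range propagates from `l` to every `m ∈ (0, 2l)`: the equation `m u - A u = z` is the
fixed point equation `u = (l - A)⁻¹ (z + (l - m) u)` of a contraction. -/
theorem IsDissipative.hasFullRange_of_lt_two_mul [CompleteSpace E] {G : Submodule ℝ (E × E)}
    (hG : IsDissipative G) {l m : ℝ} (hl : 0 < l) (hr : HasFullRange G l) (hm : 0 < m)
    (hml : m < 2 * l) : HasFullRange G m := by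
  obtain ⟨R, hRG, hR⟩ := hG.exists_resolvent hl hr
  intro z
  have hK : l⁻¹ * |l - m| < 1 := by
    rw [inv_mul_lt_iff₀ hl, mul_one, abs_lt]
    constructor <;> linarith
  have hK0 : 0 ≤ l⁻¹ * |l - m| := by positivity
  have hc : ContractingWith ⟨l⁻¹ * |l - m|, hK0⟩ fun u => R (z + (l - m) • u) := by
    refine ⟨by exact_mod_cast hK, LipschitzWith.of_dist_le_mul fun u v => ?_⟩
    rw [dist_eq_norm, dist_eq_norm, ← map_sub]
    refine (hR _).trans (le_of_eq ?_)
    rw [add_sub_add_left_eq_sub, ← smul_sub, norm_smul, Real.norm_eq_abs, ← mul_assoc]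
    rfl
  have hu := hc.fixedPoint_isFixedPt
  set u := ContractingWith.fixedPoint _ hc
  have hu' : R (z + (l - m) • u) = u := hu
  have h := hRG (z + (l - m) • u)
  rw [hu'] at h
  exact ⟨_, h, by simp only; rw [sub_smul]; abel⟩

theorem IsDissipative.hasFullRange [CompleteSpace E] {G : Submodule ℝ (E × E)}
    (hG : IsDissipative G) {l : ℝ} (hl : 0 < l) (hr : HasFullRange G l) {m : ℝ} (hm : 0 < m) :
    HasFullRange G m := by
  have h : ∀ n : ℕ, HasFullRange G ((3 / 2) ^ n * l) := by
    intro n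
    induction n with
    | zero => simpa using hr
    | succ n ih =>
      have : 0 < (3 / 2 : ℝ) ^ n * l := by positivity
      exact hG.hasFullRange_of_lt_two_mul this ih (by positivity) (by rw [pow_succ]; linarith)
  obtain ⟨n, hn⟩ := pow_unbounded_of_one_lt (m / l) (by norm_num : (1 : ℝ) < 3 / 2)
  rw [div_lt_iff₀ hl] at hn
  exact hG.hasFullRange_of_lt_two_mul (by positivity) (h n) hm (by linarith)

/-! ### Yosida approximation -/

/-- The Yosida approximation `l² R - l = l A R`, where `R = (l - A)⁻¹`. -/
def yosida (l : ℝ) (R : E →L[ℝ] E) : E →L[ℝ] E := l ^ 2 • R - l • 1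

/-- On the domain of `A` the Yosida approximation is `l R A`. -/
theorem yosida_apply {G : Submodule ℝ (E × E)} (hG : IsDissipative G) {l : ℝ} (hl : 0 < l)
    {R : E →L[ℝ] E} (hR : ∀ z, (R z, l • R z - z) ∈ G) {x y : E} (hxy : (x, y) ∈ G) :
    yosida l R x = l • R y := by
  have h : R (l • x - y) = x := congrArg Prod.fst (hG.ext hl (hR (l • x - y)) hxy (by simp))
  rw [map_sub, map_smul] at h
  have h2 : R y = l • R x - x := by rw [← sub_eq_iff_eq_add.2 (sub_eq_iff_eq_add'.1 h)]
  simp only [yosida, sub_apply, smul_apply,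
    one_apply_eq_self, h2, smul_sub, smul_smul, pow_two]

/-- Resolvents of the same relation commute, by the resolvent identity. -/
theorem resolvent_commute {G : Submodule ℝ (E × E)} (hG : IsDissipative G) {l m : ℝ} (hl : 0 < l)
    (hm : 0 < m) {R S : E →L[ℝ] E} (hR : ∀ z, (R z, l • R z - z) ∈ G)
    (hS : ∀ z, (S z, m • S z - z) ∈ G) : Commute R S := by
  have key : ∀ {l m : ℝ} {R S : E →L[ℝ] E}, 0 < l → (∀ z, (R z, l • R z - z) ∈ G) →
      (∀ z, (S z, m • S z - z) ∈ G) → ∀ z, (l - m) • R (S z) + R z = S z := by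
    intro l m R S hl hR hS z
    rw [← map_smul, ← map_add]
    exact congrArg Prod.fst (hG.ext hl (hR ((l - m) • S z + z)) (hS z) (by
      simp only [sub_smul]; abel))
  rcases eq_or_ne l m with rfl | hlm
  · have : R = S := by
      ext z
      simpa using key hl hR hS z
    rw [this]
  · ext z
    have h1 := key hl hR hS z
    have h2 := key hm hS hR z
    have h3 : (l - m) • R (S z) = (l - m) • S (R z) := by
      rw [eq_sub_of_add_eq h1, eq_sub_of_add_eq' h2, ← neg_sub m l, neg_smul]
      abel
    exact smul_right_injective E (sub_ne_zero.2 hlm) h3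

theorem yosida_commute {l m : ℝ} {R S : E →L[ℝ] E} (h : Commute R S) :
    Commute (yosida l R) (yosida m S) := by
  unfold yosida
  refine Commute.sub_left ?_ ?_
  · exact Commute.sub_right ((h.smul_left _).smul_right _)
      (((Commute.one_right R).smul_left _).smul_right _)
  · exact Commute.sub_right (((Commute.one_left S).smul_left _).smul_right _)
      (((Commute.one_left _).smul_left _).smul_right _)

theorem norm_exp_le_exp_norm [CompleteSpace E] (B : E →L[ℝ] E) :
    ‖NormedSpace.exp B‖ ≤ Real.exp ‖B‖ := by
  have h1 : ∀ n : ℕ, ‖((n.factorial : ℝ)⁻¹) • B ^ n‖ ≤ (n.factorial : ℝ)⁻¹ • ‖B‖ ^ n := by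
    intro n
    rw [norm_smul, norm_inv, RCLike.norm_natCast, smul_eq_mul]
    gcongr
    rcases n.eq_zero_or_pos with rfl | hn
    · rw [pow_zero, pow_zero]
      exact ContinuousLinearMap.norm_id_le
    · exact norm_pow_le' B hn
  have h2 := NormedSpace.exp_series_hasSum_exp' (𝕂 := ℝ) (‖B‖)
  rw [Real.exp_eq_exp_ℝ, NormedSpace.exp_eq_tsum ℝ (𝔸 := E →L[ℝ] E)]
  exact tsum_of_norm_bounded h2 h1

theorem exp_add_smul [CompleteSpace E] {B C : E →L[ℝ] E} (h : Commute B C) :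
    NormedSpace.exp (B + C) = NormedSpace.exp B * NormedSpace.exp C := by
  let _ : NormedAlgebra ℚ (E →L[ℝ] E) := NormedAlgebra.restrictScalars ℚ ℝ _
  exact NormedSpace.exp_add_of_commute h

/-- The exponential of a Yosida approximation is a contraction. -/
theorem norm_exp_yosida_le_one [CompleteSpace E] {l : ℝ} (hl : 0 < l) {R : E →L[ℝ] E}
    (hR : ∀ z, ‖R z‖ ≤ l⁻¹ * ‖z‖) {t : ℝ} (ht : 0 ≤ t) :
    ‖NormedSpace.exp (t • yosida l R)‖ ≤ 1 := by
  have hR' : ‖R‖ ≤ l⁻¹ := R.opNorm_le_bound (by positivity) hR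
  have h1 : t • yosida l R = (t * l ^ 2) • R + algebraMap ℝ (E →L[ℝ] E) (-(t * l)) := by
    rw [yosida, Algebra.algebraMap_eq_smul_one, smul_sub, smul_smul, smul_smul, neg_smul,
      sub_eq_add_neg]
  rw [h1, exp_add_smul (Algebra.commutes (-(t * l)) ((t * l ^ 2) • R) : Commute _ _).symm,
    ← NormedSpace.algebraMap_exp_comm,
    ← Real.exp_eq_exp_ℝ, Algebra.algebraMap_eq_smul_one, mul_smul_comm, mul_one, norm_smul,
    Real.norm_eq_abs, Real.abs_exp]
  calc Real.exp (-(t * l)) * ‖NormedSpace.exp ((t * l ^ 2) • R)‖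
      ≤ Real.exp (-(t * l)) * Real.exp (t * l) := by
        gcongr
        refine (norm_exp_le_exp_norm _).trans (Real.exp_le_exp.2 ?_)
        rw [norm_smul, Real.norm_eq_abs, abs_of_nonneg (by positivity)]
        calc t * l ^ 2 * ‖R‖ ≤ t * l ^ 2 * l⁻¹ := by gcongr
          _ = t * l := by field_simp
    _ = 1 := by rw [← Real.exp_add, neg_add_cancel, Real.exp_zero]

/-- Contraction semigroups generated by commuting bounded operators differ by at most the
difference of the generators times `t`: differentiate `s ↦ exp (t C) exp (s (B - C)) x`, which is
`exp (s B) exp ((t - s) C) x`. -/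
theorem norm_exp_sub_exp_le [CompleteSpace E] {B C : E →L[ℝ] E} (h : Commute B C)
    (hB : ∀ t : ℝ, 0 ≤ t → ‖NormedSpace.exp (t • B)‖ ≤ 1)
    (hC : ∀ t : ℝ, 0 ≤ t → ‖NormedSpace.exp (t • C)‖ ≤ 1) {t : ℝ} (ht : 0 ≤ t) (x : E) :
    ‖NormedSpace.exp (t • B) x - NormedSpace.exp (t • C) x‖ ≤ ‖B x - C x‖ * t := by
  have hd : ∀ s : ℝ, HasDerivAt
      (fun s : ℝ => NormedSpace.exp (t • C) (NormedSpace.exp (s • (B - C)) x))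
      (NormedSpace.exp (t • C) (NormedSpace.exp (s • (B - C)) (B x - C x))) s := by
    intro s
    have h1 := hasDerivAt_exp_smul_const (𝕂 := ℝ) (B - C) s
    have h2 := (((ContinuousLinearMap.apply ℝ E x).hasFDerivAt).comp_hasDerivAt s h1)
    exact ((NormedSpace.exp (t • C)).hasFDerivAt).comp_hasDerivAt s h2
  have hbd : ∀ s ∈ Ico (0 : ℝ) t,
      ‖NormedSpace.exp (t • C) (NormedSpace.exp (s • (B - C)) (B x - C x))‖ ≤ ‖B x - C x‖ := by
    intro s hs
    have hcomm : Commute ((t - s) • C) (s • B) := (h.symm.smul_left _).smul_right _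
    have hcomm' : Commute (t • C) (s • (B - C)) :=
      ((h.symm.sub_right (Commute.refl C)).smul_left _).smul_right _
    have e : NormedSpace.exp (t • C) * NormedSpace.exp (s • (B - C))
        = NormedSpace.exp ((t - s) • C) * NormedSpace.exp (s • B) := by
      rw [← exp_add_smul hcomm, ← exp_add_smul hcomm']
      congr 1
      rw [sub_smul, smul_sub]; abel
    rw [← mul_apply_eq_comp, e, mul_apply_eq_comp]
    refine ((NormedSpace.exp ((t - s) • C)).le_of_opNorm_le
      (hC _ (sub_nonneg.2 hs.2.le)) _).trans ?_
    rw [one_mul]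
    simpa using (NormedSpace.exp (s • B)).le_of_opNorm_le (hB s hs.1) (B x - C x)
  have h3 := norm_image_sub_le_of_norm_deriv_le_segment'
    (fun s _ => (hd s).hasDerivWithinAt) hbd t (right_mem_Icc.2 ht)
  have e1 : NormedSpace.exp (t • C) * NormedSpace.exp (t • (B - C)) = NormedSpace.exp (t • B) := by
    rw [← exp_add_smul (((h.symm.sub_right (Commute.refl C)).smul_left _).smul_right _), ← smul_add]
    congr 2
    abel
  have e2 := DFunLike.congr_fun e1 x
  rw [mul_apply_eq_comp] at e2
  simpa [e2] using h3

/-! ### The generation theorem -/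

theorem tendsto_zero_of_dense {ι : Type*} {f : Filter ι} {B : ι → E →L[ℝ] E} {C : ℝ}
    (hB : ∀ i x, ‖B i x‖ ≤ C * ‖x‖) {D : Set E} (hD : Dense D)
    (h : ∀ x ∈ D, Tendsto (fun i => B i x) f (𝓝 0)) (x : E) :
    Tendsto (fun i => B i x) f (𝓝 0) := by
  rw [Metric.tendsto_nhds]
  intro ε hε
  obtain ⟨y, hy, hxy⟩ := hD.exists_dist_lt x (ε := ε / (2 * (|C| + 1))) (by positivity)
  filter_upwards [(Metric.tendsto_nhds.1 (h y hy)) (ε / 2) (half_pos hε)] with i hi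
  rw [dist_zero_right] at hi ⊢
  rw [lt_div_iff₀ (by positivity), dist_eq_norm] at hxy
  have h1 := hB i (x - y)
  rw [map_sub] at h1
  have h2 : ‖B i x‖ ≤ ‖B i x - B i y‖ + ‖B i y‖ := norm_le_norm_sub_add _ _
  have h3 : C * ‖x - y‖ ≤ (|C| + 1) * ‖x - y‖ := by
    gcongr
    linarith [le_abs_self C]
  nlinarith

theorem norm_apply_le_of_norm_le_one {B : E →L[ℝ] E} (hB : ‖B‖ ≤ 1) (x : E) : ‖B x‖ ≤ ‖x‖ := by
  simpa using B.le_of_opNorm_le hB x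

theorem norm_apply_sub_self_le {B : E →L[ℝ] E} (hB : ‖B‖ ≤ 1) (x : E) :
    ‖B x - x‖ ≤ 2 * ‖x‖ := by
  linarith [norm_sub_le (B x) x, norm_apply_le_of_norm_le_one hB x]

/-- `‖exp (t B) x - x - t B x‖ ≤ t c` when `exp (s B)` moves `B x` by at most `c` for `s ≤ t`. -/
theorem norm_exp_sub_sub_le [CompleteSpace E] {B : E →L[ℝ] E} {t c : ℝ} (ht : 0 ≤ t) (x : E)
    (hc : ∀ s ∈ Ico 0 t, ‖NormedSpace.exp (s • B) (B x) - B x‖ ≤ c) :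
    ‖NormedSpace.exp (t • B) x - x - t • B x‖ ≤ c * t := by
  have hd : ∀ s : ℝ, HasDerivAt (fun s : ℝ => NormedSpace.exp (s • B) x - s • B x)
      (NormedSpace.exp (s • B) (B x) - B x) s := by
    intro s
    have h1 := hasDerivAt_exp_smul_const (𝕂 := ℝ) B s
    have h2 := (((ContinuousLinearMap.apply ℝ E x).hasFDerivAt).comp_hasDerivAt s h1)
    have h3 := (hasDerivAt_id s).smul_const (B x)
    rw [one_smul] at h3
    exact h2.sub h3
  have h := norm_image_sub_le_of_norm_deriv_le_segment'
    (fun s _ => (hd s).hasDerivWithinAt) hc t (right_mem_Icc.2 ht)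
  simpa [sub_right_comm] using h

/-- The number `1` is not an eigenvalue of the generator of a contraction semigroup. -/
theorem eq_zero_of_tendsto_quotient {T : ℝ≥0 → E →L[ℝ] E} (hT : ∀ t, ‖T t‖ ≤ 1) {w : E}
    (h : Tendsto (fun t : ℝ≥0 => (t : ℝ)⁻¹ • (T t w - w)) (𝓝[>] 0) (𝓝 w)) : w = 0 := by
  have h1 : Tendsto (fun t : ℝ≥0 => ‖w - (t : ℝ)⁻¹ • (T t w - w)‖) (𝓝[>] 0) (𝓝 ‖w - w‖) :=
    (h.const_sub w).norm
  rw [sub_self, norm_zero] at h1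
  refine norm_le_zero_iff.1 (ge_of_tendsto h1 ?_)
  filter_upwards [self_mem_nhdsWithin] with t ht
  have ht' : (0 : ℝ) < t := ht
  have h2 : w - (t : ℝ)⁻¹ • (T t w - w) = (1 + (t : ℝ)⁻¹) • w - (t : ℝ)⁻¹ • T t w := by
    rw [smul_sub, add_smul, one_smul]; abel
  have h3 := norm_sub_norm_le ((1 + (t : ℝ)⁻¹) • w) ((t : ℝ)⁻¹ • T t w)
  rw [← h2, norm_smul, norm_smul, Real.norm_of_nonneg (by positivity),
    Real.norm_of_nonneg (by positivity)] at h3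
  have h4 : (t : ℝ)⁻¹ * ‖T t w‖ ≤ (t : ℝ)⁻¹ * ‖w‖ := by
    gcongr
    exact norm_apply_le_of_norm_le_one (hT t) w
  linarith

/-- **Lumer–Phillips theorem** for linear relations. The semigroup is the strong limit of the
exponentials of the Yosida approximations `Y n`, which converge to `A` on the domain. Its generator
extends `A`, and it is no larger since `1 - A` is onto and `1` minus the generator is injective. -/
theorem IsDissipative.exists_semigroup [CompleteSpace E] {G : Submodule ℝ (E × E)}
    (hG : IsDissipative G) (hd : Dense (Prod.fst '' (G : Set (E × E)))) {l : ℝ} (hl : 0 < l)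
    (hr : HasFullRange G l) :
    ∃ A : E →ₗ.[ℝ] E, A.graph = G ∧
      ∃ T : ℝ≥0 → E →L[ℝ] E, IsContractionSemigroup T ∧ IsGenerator T A := by
  have hgraph : G.toLinearPMap.graph = G := by
    refine G.toLinearPMap_graph_eq fun p hp hp1 => ?_
    exact hG.eq_zero_of_zero_mem hd (by rw [← hp1]; exact hp)
  refine ⟨G.toLinearPMap, hgraph, ?_⟩
  have hpos : ∀ n : ℕ, (0 : ℝ) < n + 1 := fun n => by positivity
  choose R hRG hR using fun n : ℕ => hG.exists_resolvent (hpos n) (hG.hasFullRange hl hr (hpos n))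
  set Y : ℕ → E →L[ℝ] E := fun n => yosida (n + 1) (R n) with hY
  set S : ℕ → ℝ → E →L[ℝ] E := fun n t => NormedSpace.exp (t • Y n) with hS
  have hS1 : ∀ n t, 0 ≤ t → ‖S n t‖ ≤ 1 := fun n t ht => norm_exp_yosida_le_one (hpos n) (hR n) ht
  have hcomm : ∀ n m, Commute (Y n) (Y m) := fun n m =>
    yosida_commute (resolvent_commute hG (hpos n) (hpos m) (hRG n) (hRG m))
  have hYG : ∀ n {x y : E}, (x, y) ∈ G → Y n x = ((n : ℝ) + 1) • R n y := fun n _ _ hxy =>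
    yosida_apply hG (hpos n) (hRG n) hxy
  have hRb : ∀ (n : ℕ) z, ‖((n : ℝ) + 1) • R n z‖ ≤ ‖z‖ := by
    intro n z
    rw [norm_smul, Real.norm_of_nonneg (hpos n).le]
    exact (le_inv_mul_iff₀ (hpos n)).1 (hR n z)
  -- `n (n - A)⁻¹ z → z`, first on the domain
  have hRlim : ∀ z, Tendsto (fun n : ℕ => ((n : ℝ) + 1) • R n z) atTop (𝓝 z) := by
    intro z
    have := tendsto_zero_of_dense (f := atTop) (C := 2)
      (B := fun n : ℕ => ((n : ℝ) + 1) • R n - 1) (fun n x => ?_) hd ?_ z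
    · rw [tendsto_iff_norm_sub_tendsto_zero]
      simpa using this.norm
    · have := hRb n x
      have h2 := norm_sub_le (((n : ℝ) + 1) • R n x) x
      simp only [sub_apply, smul_apply, one_apply_eq_self]
      linarith
    · rintro _ ⟨⟨x, y⟩, hxy, rfl⟩
      have h1 : ∀ n : ℕ, (((n : ℝ) + 1) • R n - 1) x = R n y := by
        intro n
        have h2 := hYG n hxy
        have h3 : Y n x = ((n : ℝ) + 1) • ((((n : ℝ) + 1) • R n - 1) x) := by
          simp only [hY, yosida, sub_apply, smul_apply, one_apply_eq_self, smul_sub, smul_smul,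
            pow_two]
        rw [h3] at h2
        exact smul_right_injective E (hpos n).ne' h2
      simp only [h1]
      refine squeeze_zero_norm (fun n => hR n y) ?_
      simpa using (tendsto_one_div_add_atTop_nhds_zero_nat (𝕜 := ℝ)).mul_const ‖y‖
  have hYlim : ∀ {x y : E}, (x, y) ∈ G → Tendsto (fun n => Y n x) atTop (𝓝 y) := by
    intro x y hxy
    simp only [hYG _ hxy]
    exact hRlim y
  have hYb : ∀ n {x y : E}, (x, y) ∈ G → ‖Y n x‖ ≤ ‖y‖ := by
    intro n x y hxy
    rw [hYG n hxy]
    exact hRb n y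
  have hcauchy : ∀ (t : ℝ≥0) x, CauchySeq fun n => S n t x := by
    intro t x
    rw [cauchySeq_iff_tendsto_dist_atTop_0]
    have := tendsto_zero_of_dense (f := atTop) (C := 2)
      (B := fun p : ℕ × ℕ => S p.1 t - S p.2 t) (fun p x => ?_) hd ?_ x
    · simpa [dist_eq_norm] using this.norm
    · rw [sub_apply]
      linarith [norm_sub_le (S p.1 t x) (S p.2 t x),
        norm_apply_le_of_norm_le_one (hS1 p.1 t t.2) x,
        norm_apply_le_of_norm_le_one (hS1 p.2 t t.2) x]
    · rintro _ ⟨⟨x, y⟩, hxy, rfl⟩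
      have h1 := cauchySeq_iff_tendsto_dist_atTop_0.1 (hYlim hxy).cauchySeq
      refine squeeze_zero_norm
        (fun p => norm_exp_sub_exp_le (hcomm p.1 p.2) (hS1 p.1) (hS1 p.2) t.2 x) ?_
      simpa [dist_eq_norm] using h1.mul_const (t : ℝ)
  choose T' hT' using fun t x => cauchySeq_tendsto_of_complete (hcauchy t x)
  set T : ℝ≥0 → E →L[ℝ] E := fun t =>
    continuousLinearMapOfTendsto (fun n => S n t) (tendsto_pi_nhds.2 (hT' t)) with hTdef
  have hTlim : ∀ (t : ℝ≥0) x, Tendsto (fun n => S n t x) atTop (𝓝 (T t x)) := hT'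
  have hT1 : ∀ t, ‖T t‖ ≤ 1 := fun t => (T t).opNorm_le_bound zero_le_one fun x => by
    rw [one_mul]
    exact le_of_tendsto (hTlim t x).norm
      (Eventually.of_forall fun n => norm_apply_le_of_norm_le_one (hS1 n t t.2) x)
  have hTadd : ∀ s t, T (s + t) = (T s).comp (T t) := by
    intro s t
    ext x
    refine tendsto_nhds_unique (hTlim (s + t) x) ?_
    have h1 : ∀ n, S n ((s + t : ℝ≥0) : ℝ) x = S n s (S n t x - T t x) + S n s (T t x) := by
      intro n
      rw [← map_add, sub_add_cancel, ← mul_apply_eq_comp]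
      simp only [hS]
      rw [← exp_add_smul (((Commute.refl _).smul_left _).smul_right _), ← add_smul, NNReal.coe_add]
    simp only [h1]
    have h2 : Tendsto (fun n => S n s (S n t x - T t x)) atTop (𝓝 0) :=
      squeeze_zero_norm (fun n => norm_apply_le_of_norm_le_one (hS1 n s s.2) _)
        (tendsto_iff_norm_sub_tendsto_zero.1 (hTlim t x))
    simpa using h2.add (hTlim s (T t x))
  have hS0 : ∀ n, S n 0 = 1 := fun n => by simp [hS]
  have hT0 : T 0 = ContinuousLinearMap.id ℝ E := by
    ext x
    refine tendsto_nhds_unique (hTlim 0 x) ?_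
    simp [hS0]
  -- on the domain, orbits are Lipschitz at time zero
  have hSlip : ∀ n (t : ℝ), 0 ≤ t → ∀ {x y : E}, (x, y) ∈ G → ‖S n t x - x‖ ≤ ‖y‖ * t := by
    intro n t ht x y hxy
    have h1 := norm_exp_sub_exp_le (Commute.zero_right (Y n)) (hS1 n)
      (fun t _ => by
        rw [smul_zero, NormedSpace.exp_zero]
        exact ContinuousLinearMap.norm_id_le) ht x
    simp only [smul_zero, NormedSpace.exp_zero, one_apply_eq_self, zero_apply, sub_zero] at h1
    exact h1.trans (by gcongr; exact hYb n hxy)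
  have hTzero : ∀ x, Tendsto (fun t => T t x - x) (𝓝 0) (𝓝 0) := by
    intro x
    refine tendsto_zero_of_dense (f := 𝓝 (0 : ℝ≥0)) (C := 2) (B := fun t => T t - 1)
      (fun t x => norm_apply_sub_self_le (hT1 t) x) hd ?_ x
    rintro _ ⟨⟨x, y⟩, hxy, rfl⟩
    have h1 : ∀ t : ℝ≥0, ‖(T t - 1) x‖ ≤ ‖y‖ * t := fun t =>
      le_of_tendsto ((hTlim t x).sub_const x).norm
        (Eventually.of_forall fun n => hSlip n t t.2 hxy)
    refine squeeze_zero_norm h1 ?_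
    have : Tendsto (fun t : ℝ≥0 => ‖y‖ * (t : ℝ)) (𝓝 0) (𝓝 (‖y‖ * ((0 : ℝ≥0) : ℝ))) :=
      Continuous.tendsto (by fun_prop) 0
    simpa using this
  have hTcont : ∀ x, Continuous fun t => T t x := by
    intro x
    have h1 : ∀ s t : ℝ≥0, s ≤ t → ‖T t x - T s x‖ ≤ ‖T (t - s) x - x‖ := by
      intro s t hst
      have h2 : T t x = T s (T (t - s) x) := by
        rw [← ContinuousLinearMap.comp_apply, ← hTadd, add_tsub_cancel_of_le hst]
      rw [h2, ← map_sub]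
      exact norm_apply_le_of_norm_le_one (hT1 s) _
    rw [continuous_iff_continuousAt]
    intro s
    rw [ContinuousAt, tendsto_iff_norm_sub_tendsto_zero]
    have h2 : ∀ t, ‖T t x - T s x‖ ≤ ‖T (t - s) x - x‖ + ‖T (s - t) x - x‖ := by
      intro t
      rcases le_total s t with h | h
      · exact (h1 s t h).trans (le_add_of_nonneg_right (norm_nonneg _))
      · rw [norm_sub_rev]
        exact (h1 t s h).trans (le_add_of_nonneg_left (norm_nonneg _))
    refine squeeze_zero (fun t => norm_nonneg _) h2 ?_
    have e1 : Tendsto (fun t : ℝ≥0 => t - s) (𝓝 s) (𝓝 0) := by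
      simpa using (Continuous.tendsto (by fun_prop : Continuous fun t : ℝ≥0 => t - s) s)
    have e2 : Tendsto (fun t : ℝ≥0 => s - t) (𝓝 s) (𝓝 0) := by
      simpa using (Continuous.tendsto (by fun_prop : Continuous fun t : ℝ≥0 => s - t) s)
    simpa using ((hTzero x).comp e1).norm.add ((hTzero x).comp e2).norm
  have hgen : ∀ {x y : E}, (x, y) ∈ G →
      Tendsto (fun t : ℝ≥0 => (t : ℝ)⁻¹ • (T t x - x)) (𝓝[>] 0) (𝓝 y) := by
    intro x y hxy
    rw [Metric.tendsto_nhds]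
    intro ε hε
    -- approximate `y` by an element `y'` of the domain, on which orbits are Lipschitz
    obtain ⟨_, ⟨⟨y', z⟩, hyz, rfl⟩, hy'⟩ := hd.exists_dist_lt y (ε := ε / 4) (by positivity)
    simp only [dist_eq_norm] at hy'
    have h1 : ∀ t : ℝ≥0, ‖T t x - x - (t : ℝ) • y‖ ≤ (2 * ‖y - y'‖ + ‖z‖ * t) * t := by
      intro t
      have h2 : ∀ n, ‖S n t x - x - (t : ℝ) • Y n x‖
          ≤ (2 * ‖Y n x - y‖ + (2 * ‖y - y'‖ + ‖z‖ * t)) * t := by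
        intro n
        refine norm_exp_sub_sub_le t.2 x fun s hs => ?_
        have e1 := norm_apply_sub_self_le (hS1 n s hs.1) (Y n x - y)
        have e2 := norm_apply_sub_self_le (hS1 n s hs.1) (y - y')
        have e3 := hSlip n s hs.1 hyz
        have e4 : ‖z‖ * s ≤ ‖z‖ * t := by
          gcongr
          exact hs.2.le
        have e5 : S n s (Y n x) - Y n x = (S n s (Y n x - y) - (Y n x - y))
            + (S n s (y - y') - (y - y')) + (S n s y' - y') := by
          simp only [map_sub]; abel
        change ‖S n s (Y n x) - Y n x‖ ≤ _
        rw [e5]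
        linarith [norm_add₃_le (a := S n s (Y n x - y) - (Y n x - y))
          (b := S n s (y - y') - (y - y')) (c := S n s y' - y')]
      have h3 : Tendsto (fun n => (2 * ‖Y n x - y‖ + (2 * ‖y - y'‖ + ‖z‖ * t)) * t) atTop
          (𝓝 ((2 * 0 + (2 * ‖y - y'‖ + ‖z‖ * t)) * t)) :=
        (((tendsto_iff_norm_sub_tendsto_zero.1 (hYlim hxy)).const_mul 2).add_const _).mul_const _
      rw [mul_zero, zero_add] at h3
      exact le_of_tendsto_of_tendsto'
        (((hTlim t x).sub_const x).sub ((hYlim hxy).const_smul (t : ℝ))).norm h3 h2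
    have h2 : ∀ᶠ t : ℝ≥0 in 𝓝[>] 0, ‖z‖ * t < ε / 2 := by
      have : Tendsto (fun t : ℝ≥0 => ‖z‖ * (t : ℝ)) (𝓝 0) (𝓝 (‖z‖ * ((0 : ℝ≥0) : ℝ))) :=
        Continuous.tendsto (by fun_prop) 0
      rw [NNReal.coe_zero, mul_zero] at this
      exact nhdsWithin_le_nhds (this.eventually (gt_mem_nhds (half_pos hε)))
    filter_upwards [self_mem_nhdsWithin, h2] with t ht ht2
    have ht' : (0 : ℝ) < t := ht
    have e : (t : ℝ)⁻¹ • (T t x - x) - y = (t : ℝ)⁻¹ • (T t x - x - (t : ℝ) • y) := by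
      rw [smul_sub _ (T t x - x), inv_smul_smul₀ ht'.ne']
    rw [dist_eq_norm, e, norm_smul, norm_inv, Real.norm_of_nonneg ht'.le]
    calc (t : ℝ)⁻¹ * ‖T t x - x - (t : ℝ) • y‖
        ≤ (t : ℝ)⁻¹ * ((2 * ‖y - y'‖ + ‖z‖ * t) * t) := by
          gcongr
          exact h1 t
      _ = 2 * ‖y - y'‖ + ‖z‖ * t := by field_simp
      _ < ε := by linarith
  refine ⟨T, ⟨hT0, hTadd, hT1, hTcont⟩, fun x y => ?_⟩
  rw [hgraph]
  refine ⟨hgen, fun h => ?_⟩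
  obtain ⟨⟨u, v⟩, huv, hz⟩ := hG.hasFullRange hl hr one_pos (x - y)
  simp only [one_smul] at hz
  have hw : Tendsto (fun t : ℝ≥0 => (t : ℝ)⁻¹ • (T t (x - u) - (x - u))) (𝓝[>] 0)
      (𝓝 (x - u)) := by
    have e1 : x - u = y - v := by
      rw [sub_eq_sub_iff_add_eq_add] at hz ⊢
      rw [add_comm y u, hz]
    nth_rewrite 3 [e1]
    refine (h.sub (hgen huv)).congr fun t => ?_
    rw [← smul_sub, map_sub]
    congr 1
    abel
  have hxu : x = u := sub_eq_zero.1 (eq_zero_of_tendsto_quotient hT1 hw)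
  have hyv : y = v := by
    rw [← hxu] at hz
    exact (sub_right_injective hz).symm
  rw [hxu, hyv]
  exact huv

end Generation

/-! ### The kernel `(F_μ(x) - F_μ(y))⁺` -/

section Kernel

variable {μ ν : Measure I}

theorem F_mono (μ : Measure I) [IsProbabilityMeasure μ] : Monotone (F μ) :=
  fun _ _ hxy => measureReal_mono (Iic_subset_Iic.2 hxy)

theorem F_nonneg (μ : Measure I) (x : I) : 0 ≤ F μ x := measureReal_nonneg

theorem F_one (μ : Measure I) [IsProbabilityMeasure μ] : F μ 1 = 1 := by
  have : Iic (1 : I) = univ := eq_univ_of_forall fun x => unitInterval.le_one'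
  simp [F, this]

theorem F_le_one (μ : Measure I) [IsProbabilityMeasure μ] (x : I) : F μ x ≤ 1 :=
  measureReal_le_one

theorem Iic_zero_eq : Iic (0 : I) = {0} :=
  Set.ext fun _ => ⟨fun hx => le_antisymm hx unitInterval.nonneg', fun hx => hx.le⟩

theorem setIntegral_Iic_one (g : I → ℝ) : ∫ y in Iic 1, g y ∂ν = ∫ y, g y ∂ν := by
  have : Iic (1 : I) = univ := eq_univ_of_forall fun x => unitInterval.le_one'
  rw [this, setIntegral_univ]

theorem nabla_zero (hν : ν {0} = 0) (g : C(I, ℝ)) (b : ℝ) : nabla ν g b 0 = b := by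
  rw [nabla, Iic_zero_eq, setIntegral_measure_zero _ hν, add_zero]

/-- The kernel of the remainder in the first order Taylor formula at `x₀` (in the variable `F_μ`);
it is nonnegative and vanishes unless `y` lies between `x₀` and `x`. -/
noncomputable def remainderKernel (μ : Measure I) (x₀ x y : I) : ℝ :=
  if y ≤ x₀ then max (F μ y - F μ x) 0 else max (F μ x - F μ y) 0

theorem remainderKernel_nonneg (x₀ x y : I) : 0 ≤ remainderKernel μ x₀ x y := by
  unfold remainderKernel
  split_ifs <;> exact le_max_right _ _

theorem remainderKernel_eq_zero [IsProbabilityMeasure μ] {x₀ x y : I}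
    (h : y ∉ Ioo x₀ x) (h' : y ∉ Ioc x x₀) :
    remainderKernel μ x₀ x y = 0 := by
  unfold remainderKernel
  split_ifs with hy
  · exact max_eq_right (sub_nonpos.2 (F_mono μ (not_lt.1 fun hx => h' ⟨hx, hy⟩)))
  · exact max_eq_right (sub_nonpos.2 (F_mono μ (not_lt.1 fun hx => h ⟨not_le.1 hy, hx⟩)))

variable [IsProbabilityMeasure μ] [IsProbabilityMeasure ν] [NullSingletonClass μ]

theorem F_zero (μ : Measure I) [NullSingletonClass μ] : F μ 0 = 0 := by
  simp [F, Iic_zero_eq, measureReal_def]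

theorem continuous_F (μ : Measure I) [IsProbabilityMeasure μ] [NullSingletonClass μ] :
    Continuous (F μ) := by
  have h : F μ = fun x => ∫ y, (Iic x).indicator (fun _ => (1 : ℝ)) y ∂μ := by
    ext x
    rw [integral_indicator measurableSet_Iic]
    simp [F]
  rw [h, continuous_iff_continuousAt]
  intro x
  refine continuousAt_of_dominated (bound := fun _ => 1) ?_ ?_ (integrable_const _) ?_
  · exact Eventually.of_forall fun z =>
      (stronglyMeasurable_const.indicator measurableSet_Iic).aestronglyMeasurable
  · exact Eventually.of_forall fun z => Eventually.of_forall fun y => by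
      by_cases hy : y ∈ Iic z <;> simp [indicator, hy]
  · have : ∀ᵐ y ∂μ, y ≠ x := by simp [ae_iff]
    filter_upwards [this] with y hy
    rcases lt_or_gt_of_ne hy with hy | hy
    · refine continuousAt_const.congr (f := fun _ => (1 : ℝ)) ?_
      filter_upwards [lt_mem_nhds hy] with z hz
      simp [indicator, hz.le]
    · refine continuousAt_const.congr (f := fun _ => (0 : ℝ)) ?_
      filter_upwards [gt_mem_nhds hy] with z hz
      simp [indicator, hz]

/-- The distribution function `F_μ` as an element of `C([0,1])`. -/
def cdfMap (μ : Measure I) [IsProbabilityMeasure μ] [NullSingletonClass μ] : C(I, ℝ) :=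
  ⟨F μ, continuous_F μ⟩

@[simp]
theorem cdfMap_apply (x : I) : cdfMap μ x = F μ x := rfl

/-- The kernel `y ↦ (x ↦ (F_μ(x) - F_μ(y))⁺)`, a continuous path in `C([0,1])`. -/
def kernel (μ : Measure I) [IsProbabilityMeasure μ] [NullSingletonClass μ] : C(I, C(I, ℝ)) :=
  ContinuousMap.curry ⟨fun p => max (F μ p.2 - F μ p.1) 0,
    (((continuous_F μ).comp continuous_snd).sub
      ((continuous_F μ).comp continuous_fst)).max continuous_const⟩

@[simp]
theorem kernel_apply (y x : I) : kernel μ y x = max (F μ x - F μ y) 0 := rfl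

theorem integrable_continuousMap {E : Type*} [NormedAddCommGroup E] (φ : C(I, E)) :
    Integrable φ ν :=
  φ.continuous.integrable_of_hasCompactSupport (HasCompactSupport.of_compactSpace _)

theorem integrable_smul_kernel (g : C(I, ℝ)) : Integrable (fun y => g y • kernel μ y) ν :=
  integrable_continuousMap ⟨fun y => g y • kernel μ y, by fun_prop⟩

/-- The operator `g ↦ ∫ g(y) (F_μ(·) - F_μ(y))⁺ dν(y)` on `C([0,1])`. -/
noncomputable def potential (μ ν : Measure I) [IsProbabilityMeasure μ] [IsProbabilityMeasure ν]
    [NullSingletonClass μ] : C(I, ℝ) →L[ℝ] C(I, ℝ) :=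
  LinearMap.mkContinuous
    { toFun := fun g => ∫ y, g y • kernel μ y ∂ν
      map_add' := fun g h => by
        rw [← integral_add (integrable_smul_kernel g) (integrable_smul_kernel h)]
        simp only [ContinuousMap.add_apply, add_smul]
      map_smul' := fun c g => by
        rw [RingHom.id_apply, ← integral_smul]
        simp only [ContinuousMap.smul_apply, smul_eq_mul, mul_smul] } 1 fun g => by
    rw [one_mul]
    refine (norm_integral_le_of_norm_le_const (C := ‖g‖)
      (Eventually.of_forall fun y => ?_)).trans (by simp)
    rw [norm_smul]
    have h1 : ‖kernel μ y‖ ≤ 1 := (ContinuousMap.norm_le _ zero_le_one).2 fun x => by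
      rw [kernel_apply, Real.norm_of_nonneg (le_max_right _ _)]
      exact max_le (by linarith [F_le_one μ x, F_nonneg μ y]) zero_le_one
    calc ‖g y‖ * ‖kernel μ y‖ ≤ ‖g‖ * 1 := by
          gcongr
          exact g.norm_coe_le_norm y
      _ = ‖g‖ := mul_one _

theorem norm_potential_le : ‖potential μ ν‖ ≤ 1 :=
  LinearMap.mkContinuous_norm_le _ zero_le_one _

theorem clm_potential (L : C(I, ℝ) →L[ℝ] ℝ) (g : C(I, ℝ)) :
    L (potential μ ν g) = ∫ y, L (kernel μ y) * g y ∂ν := by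
  change L (∫ y, g y • kernel μ y ∂ν) = _
  rw [← L.integral_comp_comm (integrable_smul_kernel g)]
  simp only [map_smul, smul_eq_mul, mul_comm]

theorem potential_apply (g : C(I, ℝ)) (x : I) :
    potential μ ν g x = ∫ y, max (F μ x - F μ y) 0 * g y ∂ν :=
  clm_potential (ContinuousMap.evalCLM ℝ x) g

theorem potential_apply_eq_setIntegral (g : C(I, ℝ)) (x : I) :
    potential μ ν g x = ∫ y in Iic x, (F μ x - F μ y) * g y ∂ν := by
  rw [potential_apply, ← integral_indicator measurableSet_Iic]
  congr 1 with y
  by_cases hy : y ≤ x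
  · simp [indicator, hy, F_mono μ hy]
  · simp [indicator, hy, F_mono μ (not_le.1 hy).le]

theorem represents_iff {f g : C(I, ℝ)} {a b : ℝ} :
    Represents μ ν f g a b ↔ f = a • 1 + b • cdfMap μ + potential μ ν g := by
  rw [ContinuousMap.ext_iff]
  simp [Represents, potential_apply_eq_setIntegral]

theorem Represents.apply_zero {f g : C(I, ℝ)} {a b : ℝ} (h : Represents μ ν f g a b) :
    f 0 = a := by
  rw [represents_iff.1 h]
  simp [potential_apply, F_zero, F_nonneg]

/-- First order Taylor formula in the variable `F_μ`. -/
theorem Represents.taylor {f g : C(I, ℝ)} {a b : ℝ} (h : Represents μ ν f g a b) (x₀ x : I) :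
    f x = f x₀ + nabla ν g b x₀ * (F μ x - F μ x₀)
      + ∫ y, remainderKernel μ x₀ x y * g y ∂ν := by
  have hi : ∀ z, Integrable (fun y => max (F μ z - F μ y) 0 * g y) ν := fun z =>
    integrable_continuousMap ⟨fun y => max (F μ z - F μ y) 0 * g y, by
      have := continuous_F μ
      fun_prop⟩
  have hind : Integrable (fun y => (Iic x₀).indicator g y * (F μ x - F μ x₀)) ν :=
    ((integrable_continuousMap g).indicator measurableSet_Iic).mul_const _
  have e : ∀ y, remainderKernel μ x₀ x y * g y = max (F μ x - F μ y) 0 * g y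
      - max (F μ x₀ - F μ y) 0 * g y - (Iic x₀).indicator g y * (F μ x - F μ x₀) := by
    intro y
    unfold remainderKernel
    by_cases hy : y ≤ x₀
    · rw [if_pos hy, indicator_of_mem (mem_Iic.2 hy), max_eq_left (sub_nonneg.2 (F_mono μ hy))]
      rcases le_total (F μ x) (F μ y) with h1 | h1
      · rw [max_eq_left (sub_nonneg.2 h1), max_eq_right (sub_nonpos.2 h1)]; ring
      · rw [max_eq_right (sub_nonpos.2 h1), max_eq_left (sub_nonneg.2 h1)]; ring
    · rw [if_neg hy, indicator_of_notMem (by simpa using hy),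
        max_eq_right (sub_nonpos.2 (F_mono μ (not_le.1 hy).le))]
      ring
  have h1 : ∫ y, remainderKernel μ x₀ x y * g y ∂ν = potential μ ν g x - potential μ ν g x₀
      - (∫ y in Iic x₀, g y ∂ν) * (F μ x - F μ x₀) := by
    simp only [e]
    rw [integral_sub (f := fun y => max (F μ x - F μ y) 0 * g y - max (F μ x₀ - F μ y) 0 * g y)
      ((hi x).sub (hi x₀)) hind, integral_sub (hi x) (hi x₀), integral_mul_const,
      integral_indicator measurableSet_Iic, potential_apply, potential_apply]
  rw [h1, represents_iff.1 h]
  simp [nabla]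
  ring

end Kernel

/-! ### The spaces `C_{ν,μ}` and `C^γ_{ν,μ}` -/

section Spaces

variable {μ ν : Measure I}

theorem one_mem_CSpace : (1 : C(I, ℝ)) ∈ CSpace μ ν := fun _ _ => ⟨0, 1, fun _ _ => by simp⟩

/-- On each component `J`, the functions `a F_μ + b` form a finite dimensional, hence closed,
subspace of `J → ℝ`. -/
theorem isClosed_CSpace : IsClosed (CSpace μ ν : Set C(I, ℝ)) := by
  have h : (CSpace μ ν : Set C(I, ℝ)) = ⋂ x ∈ ν.supportᶜ,
      (fun f : C(I, ℝ) => fun y : connectedComponentIn ν.supportᶜ x => f y) ⁻¹'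
        (Submodule.span ℝ {(fun y : connectedComponentIn ν.supportᶜ x => F μ y), 1} :
          Submodule ℝ (connectedComponentIn ν.supportᶜ x → ℝ)) := by
    ext f
    simp only [mem_iInter, mem_preimage, SetLike.mem_coe, Submodule.mem_span_pair]
    refine forall₂_congr fun x _ => exists₂_congr fun a b => ?_
    rw [funext_iff]
    exact ⟨fun h y => by simp [h y y.2], fun h y hy => by simpa using (h ⟨y, hy⟩).symm⟩
  rw [h]
  refine isClosed_biInter fun x _ => IsClosed.preimage (by fun_prop) ?_
  have : FiniteDimensional ℝ (Submodule.span ℝ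
      {(fun y : connectedComponentIn ν.supportᶜ x => F μ y), 1} :
        Submodule ℝ (connectedComponentIn ν.supportᶜ x → ℝ)) :=
    FiniteDimensional.span_of_finite ℝ (toFinite _)
  exact Submodule.closed_of_finiteDimensional _

theorem isClosed_CGamma (α β : ℝ) : IsClosed (CGamma μ ν α β : Set C(I, ℝ)) := by
  have h : (CGamma μ ν α β : Set C(I, ℝ)) = (CSpace μ ν : Set C(I, ℝ)) ∩
      ({f | α = 0 → f 0 = 0} ∩ {f | β = 0 → f 1 = 0}) := rfl
  have h1 : ∀ (p : Prop) (x : I), IsClosed {f : C(I, ℝ) | p → f x = 0} := fun p x => by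
    by_cases hp : p
    · simpa [hp] using isClosed_eq (f := fun f : C(I, ℝ) => f x) (by fun_prop) continuous_const
    · simp [hp]
  rw [h]
  exact isClosed_CSpace.inter ((h1 _ 0).inter (h1 _ 1))

instance instCompleteSpaceCGamma (α β : ℝ) : CompleteSpace (CGamma μ ν α β) :=
  (isClosed_CGamma α β).completeSpace_coe

variable [IsProbabilityMeasure μ] [NullSingletonClass μ]

theorem cdfMap_mem_CSpace : cdfMap μ ∈ CSpace μ ν := fun _ _ => ⟨1, 0, fun _ _ => by simp⟩

theorem kernel_mem_CSpace {y : I} (hy : y ∈ ν.support) : kernel μ y ∈ CSpace μ ν := by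
  intro x hx
  have hconn := (isPreconnected_connectedComponentIn (F := ν.supportᶜ) (x := x)).ordConnected
  have hyJ : y ∉ connectedComponentIn ν.supportᶜ x := fun h => connectedComponentIn_subset _ _ h hy
  have hxJ := mem_connectedComponentIn hx
  rcases le_total x y with hxy | hxy
  · refine ⟨0, 0, fun z hz => ?_⟩
    have : z ≤ y := not_lt.1 fun h => hyJ (hconn.out hxJ hz ⟨hxy, h.le⟩)
    simp [F_mono μ this]
  · refine ⟨1, -F μ y, fun z hz => ?_⟩
    have : y ≤ z := not_lt.1 fun h => hyJ (hconn.out hz hxJ ⟨h.le, hxy⟩)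
    rw [kernel_apply, max_eq_left (sub_nonneg.2 (F_mono μ this))]
    ring

theorem Represents.mem_CSpace [IsProbabilityMeasure ν] {f g : C(I, ℝ)} {a b : ℝ}
    (h : Represents μ ν f g a b) : f ∈ CSpace μ ν := by
  intro x hx
  refine ⟨nabla ν g b x, f x - nabla ν g b x * F μ x, fun z hz => ?_⟩
  have hconn := (isPreconnected_connectedComponentIn (F := ν.supportᶜ) (x := x)).ordConnected
  have hxJ := mem_connectedComponentIn hx
  have h0 : ∫ y, remainderKernel μ x z y * g y ∂ν = 0 := by
    refine integral_eq_zero_of_ae ?_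
    have : ∀ᵐ y ∂ν, y ∈ ν.support := Measure.support_mem_ae
    filter_upwards [this] with y hy
    have hyJ : y ∉ connectedComponentIn ν.supportᶜ x := fun h =>
      connectedComponentIn_subset _ _ h hy
    rw [remainderKernel_eq_zero, zero_mul, Pi.zero_apply]
    · exact fun hy' => hyJ (hconn.out hxJ hz ⟨hy'.1.le, hy'.2.le⟩)
    · exact fun hy' => hyJ (hconn.out hz hxJ ⟨hy'.1.le, hy'.2⟩)
  rw [h.taylor x z, h0]
  ring

end Spaces

/-! ### Dissipativity -/

section Dissipative

variable {μ ν : Measure I} [IsProbabilityMeasure μ] [IsProbabilityMeasure ν] [NullSingletonClass μ]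
  {f g : C(I, ℝ)} {a b α β M : ℝ} {x₀ : I}

theorem setIntegral_pos_of_pos {ν : Measure I} [IsProbabilityMeasure ν] {g : C(I, ℝ)} {s : Set I}
    (hs : MeasurableSet s) (hg : ∀ x ∈ s, 0 < g x) (hν : ν s ≠ 0) : 0 < ∫ y in s, g y ∂ν := by
  rw [setIntegral_pos_iff_support_of_nonneg_ae
    ((ae_restrict_iff' hs).2 (Eventually.of_forall fun x hx => (hg x hx).le))
    (integrable_continuousMap g).integrableOn]
  rw [inter_eq_right.2 fun x hx => Function.mem_support.2 (hg x hx).ne']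
  exact pos_iff_ne_zero.2 hν

theorem nabla_one {ν : Measure I} [IsProbabilityMeasure ν] (g : C(I, ℝ)) (b : ℝ) (x : I) :
    nabla ν g b 1 = nabla ν g b x + ∫ y in Ioi x, g y ∂ν := by
  rw [nabla, nabla, setIntegral_Iic_one, ← integral_add_compl (measurableSet_Iic (a := x))
    (integrable_continuousMap g), compl_Iic, add_assoc]

theorem Represents.slope_lt_of_convex_right (h : Represents μ ν f g a b) (hx : M < f x₀)
    (hg : ∀ x, M < f x → 0 < g x) {z : I} (hz : x₀ ≤ z) (hfz : f z ≤ M) :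
    nabla ν g b x₀ < 0 := by
  obtain ⟨q, ⟨hq0, hqM⟩, hq⟩ := ((isClosed_Ici (a := x₀)).inter
    (isClosed_le f.continuous (continuous_const (y := M)))).isCompact.exists_isLeast ⟨z, hz, hfz⟩
  have hlt : ∀ y ∈ Ioo x₀ q, M < f y := fun y hy =>
    not_le.1 fun hyM => (hq ⟨hy.1.le, hyM⟩).not_gt hy.2
  have hnn : 0 ≤ ∫ y, remainderKernel μ x₀ q y * g y ∂ν := integral_nonneg fun y => by
    by_cases hy : y ∈ Ioo x₀ q
    · exact mul_nonneg (remainderKernel_nonneg _ _ _) (hg y (hlt y hy)).le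
    · simp [remainderKernel_eq_zero hy fun hy' => (hy'.1.trans_le hy'.2).not_ge hq0]
  have ht := h.taylor x₀ q
  have hF := F_mono μ hq0
  simp only [mem_ofPred_eq] at hqM
  by_contra! hn
  nlinarith [mul_nonneg hn (sub_nonneg.2 hF)]

theorem Represents.slope_pos_of_convex_left (h : Represents μ ν f g a b) (hx : M < f x₀)
    (hg : ∀ x, M < f x → 0 < g x) {z : I} (hz : z ≤ x₀) (hfz : f z ≤ M) :
    0 < nabla ν g b x₀ := by
  obtain ⟨q, ⟨hq0, hqM⟩, hq⟩ := ((isClosed_Iic (a := x₀)).inter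
    (isClosed_le f.continuous (continuous_const (y := M)))).isCompact.exists_isGreatest ⟨z, hz, hfz⟩
  have hlt : ∀ y ∈ Ioc q x₀, M < f y := fun y hy =>
    not_le.1 fun hyM => (hq ⟨hy.2, hyM⟩).not_gt hy.1
  have hnn : 0 ≤ ∫ y, remainderKernel μ x₀ q y * g y ∂ν := integral_nonneg fun y => by
    by_cases hy : y ∈ Ioc q x₀
    · exact mul_nonneg (remainderKernel_nonneg _ _ _) (hg y (hlt y hy)).le
    · simp [remainderKernel_eq_zero (fun hy' => (hy'.1.trans hy'.2).not_ge hq0) hy]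
  have ht := h.taylor x₀ q
  have hF := F_mono μ hq0
  simp only [mem_ofPred_eq] at hqM
  by_contra! hn
  nlinarith [mul_nonneg_of_nonpos_of_nonpos hn (sub_nonpos.2 hF)]

theorem Represents.slope_nonpos (h : Represents μ ν f g a b) (hβ : β ∈ Icc 0 (Real.pi / 2))
    (h1 : f 1 * Real.cos β + nabla ν g b 1 * Real.sin β = 0) (hM : 0 ≤ M) (hx : M < f x₀)
    (hg : ∀ x, M < f x → 0 < g x) :
    nabla ν g b x₀ ≤ 0 ∧ (nabla ν g b x₀ = 0 → ν (Ioi x₀) = 0) := by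
  by_cases hz : ∃ z, x₀ ≤ z ∧ f z ≤ M
  · obtain ⟨z, hz, hfz⟩ := hz
    have := h.slope_lt_of_convex_right hx hg hz hfz
    exact ⟨this.le, fun h => absurd h this.ne⟩
  push Not at hz
  have hf1 := hz 1 unitInterval.le_one'
  have hcos : 0 ≤ Real.cos β := Real.cos_nonneg_of_mem_Icc ⟨by linarith [hβ.1, Real.pi_pos], hβ.2⟩
  have hβ0 : β ≠ 0 := by
    rintro rfl
    simp only [Real.cos_zero, Real.sin_zero] at h1
    linarith
  have hsin : 0 < Real.sin β :=
    Real.sin_pos_of_pos_of_lt_pi (lt_of_le_of_ne hβ.1 hβ0.symm) (by linarith [hβ.2, Real.pi_pos])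
  have hn1 : nabla ν g b 1 ≤ 0 := by
    by_contra! hn
    nlinarith [mul_pos hn hsin, mul_nonneg (hM.trans hf1.le) hcos]
  have hpos : ∀ y ∈ Ioi x₀, 0 < g y := fun y hy => hg y (hz y hy.le)
  have hnn : 0 ≤ ∫ y in Ioi x₀, g y ∂ν :=
    setIntegral_nonneg measurableSet_Ioi fun y hy => (hpos y hy).le
  have e := nabla_one (ν := ν) g b x₀
  refine ⟨by linarith, fun h0 => ?_⟩
  by_contra hν
  linarith [setIntegral_pos_of_pos measurableSet_Ioi hpos hν]

theorem Represents.slope_nonneg (h : Represents μ ν f g a b) (hα : α ∈ Icc 0 (Real.pi / 2))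
    (hν0 : ν {0} = 0) (h0 : f 0 * Real.cos α - nabla ν g b 0 * Real.sin α = 0) (hM : 0 ≤ M)
    (hx : M < f x₀) (hg : ∀ x, M < f x → 0 < g x) :
    0 ≤ nabla ν g b x₀ ∧ (nabla ν g b x₀ = 0 → ν (Iic x₀) = 0) := by
  by_cases hz : ∃ z, z ≤ x₀ ∧ f z ≤ M
  · obtain ⟨z, hz, hfz⟩ := hz
    have := h.slope_pos_of_convex_left hx hg hz hfz
    exact ⟨this.le, fun h => absurd h this.ne'⟩
  push Not at hz
  have hf0 := hz 0 unitInterval.nonneg'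
  have hcos : 0 ≤ Real.cos α := Real.cos_nonneg_of_mem_Icc ⟨by linarith [hα.1, Real.pi_pos], hα.2⟩
  have hα0 : α ≠ 0 := by
    rintro rfl
    simp only [Real.cos_zero, Real.sin_zero] at h0
    linarith
  have hsin : 0 < Real.sin α :=
    Real.sin_pos_of_pos_of_lt_pi (lt_of_le_of_ne hα.1 hα0.symm) (by linarith [hα.2, Real.pi_pos])
  rw [nabla_zero hν0] at h0
  have hb : 0 ≤ b := by
    by_contra! hn
    nlinarith [mul_pos_of_neg_of_neg hn (neg_lt_zero.2 hsin), mul_nonneg (hM.trans hf0.le) hcos]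
  have hpos : ∀ y ∈ Iic x₀, 0 < g y := fun y hy => hg y (hz y hy)
  have hnn : 0 ≤ ∫ y in Iic x₀, g y ∂ν :=
    setIntegral_nonneg measurableSet_Iic fun y hy => (hpos y hy).le
  refine ⟨add_nonneg hb hnn, fun h0 => ?_⟩
  by_contra hν
  have := setIntegral_pos_of_pos measurableSet_Iic hpos hν
  rw [nabla] at h0
  linarith

/-- Positive maximum principle. Above the level `M = ‖l f - g‖ / l` one has `g > 0`, so `f` is
convex in `F_μ` there. At a maximum point `x₀` of `f` above this level, the boundary conditions
force the slope to be `≤ 0` (looking right) and `≥ 0` (looking left), and a vanishing slope forces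
`ν = 0` on both sides. -/
theorem Represents.mul_apply_le (h : Represents μ ν f g a b)
    (hα : α ∈ Icc 0 (Real.pi / 2)) (hβ : β ∈ Icc 0 (Real.pi / 2)) (hν0 : ν {0} = 0)
    (h0 : f 0 * Real.cos α - nabla ν g b 0 * Real.sin α = 0)
    (h1 : f 1 * Real.cos β + nabla ν g b 1 * Real.sin β = 0) {l : ℝ} (hl : 0 < l) (x : I) :
    l * f x ≤ ‖l • f - g‖ := by
  obtain ⟨x₀, -, hx₀⟩ := isCompact_univ.exists_isMaxOn univ_nonempty f.continuous.continuousOn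
  by_contra! hx
  have hM : 0 ≤ ‖l • f - g‖ / l := by positivity
  have hlt : ‖l • f - g‖ / l < f x₀ := by
    rw [div_lt_iff₀' hl]
    exact hx.trans_le (mul_le_mul_of_nonneg_left (hx₀ (mem_univ x)) hl.le)
  have hg : ∀ y, ‖l • f - g‖ / l < f y → 0 < g y := by
    intro y hy
    rw [div_lt_iff₀' hl] at hy
    have := (le_abs_self _).trans ((l • f - g).norm_coe_le_norm y)
    simp only [ContinuousMap.sub_apply, ContinuousMap.smul_apply, smul_eq_mul] at this
    linarith
  obtain ⟨hr, hr'⟩ := h.slope_nonpos hβ h1 hM hlt hg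
  obtain ⟨hl, hl'⟩ := h.slope_nonneg hα hν0 h0 hM hlt hg
  have hs := le_antisymm hr hl
  have : ν univ = 0 := by
    rw [← Iic_union_Ioi (a := x₀)]
    exact measure_union_null (hl' hs) (hr' hs)
  simp at this

theorem Represents.add {f' g' : C(I, ℝ)} {a' b' : ℝ} (h : Represents μ ν f g a b)
    (h' : Represents μ ν f' g' a' b') : Represents μ ν (f + f') (g + g') (a + a') (b + b') := by
  rw [represents_iff] at *
  rw [h, h', map_add]
  module

theorem Represents.smul (c : ℝ) (h : Represents μ ν f g a b) :
    Represents μ ν (c • f) (c • g) (c * a) (c * b) := by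
  rw [represents_iff] at *
  rw [h, map_smul]
  module

theorem nabla_add {ν : Measure I} [IsProbabilityMeasure ν] (g g' : C(I, ℝ)) (b b' : ℝ) (x : I) :
    nabla ν (g + g') (b + b') x = nabla ν g b x + nabla ν g' b' x := by
  simp only [nabla, ContinuousMap.add_apply]
  rw [integral_add (integrable_continuousMap g).integrableOn
    (integrable_continuousMap g').integrableOn]
  ring

theorem nabla_smul {ν : Measure I} (c : ℝ) (g : C(I, ℝ)) (b : ℝ) (x : I) :
    nabla ν (c • g) (c * b) x = c * nabla ν g b x := by
  simp only [nabla, ContinuousMap.smul_apply, smul_eq_mul, integral_const_mul]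
  ring

theorem Represents.mul_norm_le (h : Represents μ ν f g a b)
    (hα : α ∈ Icc 0 (Real.pi / 2)) (hβ : β ∈ Icc 0 (Real.pi / 2)) (hν0 : ν {0} = 0)
    (h0 : f 0 * Real.cos α - nabla ν g b 0 * Real.sin α = 0)
    (h1 : f 1 * Real.cos β + nabla ν g b 1 * Real.sin β = 0) {l : ℝ} (hl : 0 < l) :
    l * ‖f‖ ≤ ‖l • f - g‖ := by
  rw [← le_div_iff₀' hl, ContinuousMap.norm_le _ (by positivity)]
  intro x
  rw [Real.norm_eq_abs, le_div_iff₀' hl]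
  rcases abs_choice (f x) with hx | hx
  · rw [hx]
    exact h.mul_apply_le hα hβ hν0 h0 h1 hl x
  · have := (h.smul (-1)).mul_apply_le hα hβ hν0
      (by rw [nabla_smul, ContinuousMap.smul_apply, smul_eq_mul]; linear_combination -h0)
      (by rw [nabla_smul, ContinuousMap.smul_apply, smul_eq_mul]; linear_combination -h1) hl x
    rw [smul_comm l, ← smul_sub, norm_smul] at this
    rw [hx]
    simpa using this

/-- The operator `Δ_{ν,μ}` as a linear relation in `C^γ_{ν,μ}`: the pairs `(f, g)` in this space with
`f ∈ D^s_γ(Δ_{ν,μ})` and `Δ_{ν,μ} f = g`. -/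
def laplaceGraph (μ ν : Measure I) [IsProbabilityMeasure μ] [IsProbabilityMeasure ν]
    [NullSingletonClass μ] (α β : ℝ) : Submodule ℝ (CGamma μ ν α β × CGamma μ ν α β) where
  carrier := {p | StrongOp μ ν α β (p.1 : C(I, ℝ)) (p.2 : C(I, ℝ))}
  zero_mem' := ⟨zero_mem _, 0, 0, fun x => by simp, by simp [nabla], by simp [nabla]⟩
  add_mem' := by
    rintro p q ⟨hp, a, b, hab, h0, h1⟩ ⟨hq, a', b', hab', h0', h1'⟩
    refine ⟨add_mem hp hq, a + a', b + b', hab.add hab', ?_, ?_⟩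
    · rw [Prod.snd_add, Submodule.coe_add, nabla_add, Prod.fst_add, Submodule.coe_add,
        ContinuousMap.add_apply]
      linear_combination h0 + h0'
    · rw [Prod.snd_add, Submodule.coe_add, nabla_add, Prod.fst_add, Submodule.coe_add,
        ContinuousMap.add_apply]
      linear_combination h1 + h1'
  smul_mem' := by
    rintro c p ⟨hp, a, b, hab, h0, h1⟩
    refine ⟨Submodule.smul_mem _ c hp, c * a, c * b, hab.smul c, ?_, ?_⟩
    · rw [Prod.smul_snd, Submodule.coe_smul, nabla_smul, Prod.smul_fst, Submodule.coe_smul,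
        ContinuousMap.smul_apply, smul_eq_mul]
      linear_combination c * h0
    · rw [Prod.smul_snd, Submodule.coe_smul, nabla_smul, Prod.smul_fst, Submodule.coe_smul,
        ContinuousMap.smul_apply, smul_eq_mul]
      linear_combination c * h1

theorem isDissipative_laplaceGraph (hα : α ∈ Icc 0 (Real.pi / 2)) (hβ : β ∈ Icc 0 (Real.pi / 2))
    (hν0 : ν {0} = 0) : IsDissipative (E := CGamma μ ν α β) (laplaceGraph μ ν α β) := by
  rintro p ⟨-, a, b, h, h0, h1⟩ l hl
  exact h.mul_norm_le hα hβ hν0 h0 h1 hl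

/-! ### The range condition -/

theorem mem_CGamma_of_strongOp (h : StrongOp μ ν α β f g) :
    f ∈ CGamma μ ν α β := by
  obtain ⟨-, a, b, hab, h0, h1⟩ := h
  refine ⟨hab.mem_CSpace, ?_, ?_⟩
  · rintro rfl
    simpa using h0
  · rintro rfl
    simpa using h1

theorem exists_sub_half_smul_eq {E : Type*} [NormedAddCommGroup E] [NormedSpace ℝ E]
    [CompleteSpace E] {V : E →L[ℝ] E} (hV : ‖V‖ ≤ 1) (r : E) :
    ∃ u, u - (1 / 2 : ℝ) • V u = r := by
  have hV : ‖(1 / 2 : ℝ) • V‖ < 1 := by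
    rw [norm_smul]
    norm_num
    linarith
  obtain ⟨W, hW⟩ := isUnit_one_sub_of_norm_lt_one hV
  refine ⟨(↑W⁻¹ : E →L[ℝ] E) r, ?_⟩
  have h := DFunLike.congr_fun W.mul_inv r
  rw [hW] at h
  exact h

/-- For `l = 1/2` the Volterra equation `f = a + b F_μ + ∫ (F_μ(·) - F_μ(y))⁺ (f/2 - k)(y) dν(y)` is
solved by a Neumann series. The condition at `0` holds iff `(a, b)` is a multiple
`s (sin α, cos α)`, and the condition at `1` is then an affine equation for `s`, whose linear part
does not vanish by dissipativity. -/
theorem hasFullRange_laplaceGraph (hα : α ∈ Icc 0 (Real.pi / 2)) (hβ : β ∈ Icc 0 (Real.pi / 2))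
    (hν0 : ν {0} = 0) : HasFullRange (E := CGamma μ ν α β) (laplaceGraph μ ν α β) (1 / 2) := by
  intro k
  set V := potential μ ν
  have hsolve := exists_sub_half_smul_eq (norm_potential_le (μ := μ) (ν := ν))
  obtain ⟨u, hu⟩ := hsolve (Real.sin α • 1 + Real.cos α • cdfMap μ)
  obtain ⟨w, hw⟩ := hsolve (-V k)
  have hru : Represents μ ν u ((1 / 2 : ℝ) • u) (Real.sin α) (Real.cos α) := by
    rw [represents_iff, map_smul, ← hu]
    abel
  have hrw : Represents μ ν w ((1 / 2 : ℝ) • w - k) 0 0 := by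
    rw [represents_iff, map_sub, map_smul, sub_eq_add_neg _ (V k), ← hw]
    module
  have hu0 := hru.apply_zero
  have hw0 := hrw.apply_zero
  have hm : u 1 * Real.cos β + nabla ν ((1 / 2 : ℝ) • u) (Real.cos α) 1 * Real.sin β ≠ 0 := by
    intro hm
    have h := hru.mul_norm_le hα hβ hν0 (by rw [nabla_zero hν0, hu0]; ring) hm one_half_pos
    rw [sub_self, norm_zero] at h
    have hu' : u = 0 := norm_le_zero_iff.1 (by linarith)
    have h0 : Real.sin α = 0 := by rw [← hu0, hu']; rfl
    have h1 := congrArg (fun f : C(I, ℝ) => f 1) hu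
    simp only [hu', map_zero, smul_zero, sub_zero, h0, zero_smul, zero_add,
      ContinuousMap.zero_apply, ContinuousMap.smul_apply, cdfMap_apply, F_one, smul_eq_mul,
      mul_one] at h1
    have := Real.sin_sq_add_cos_sq α
    rw [h0, ← h1] at this
    norm_num at this
  set m := u 1 * Real.cos β + nabla ν ((1 / 2 : ℝ) • u) (Real.cos α) 1 * Real.sin β
  set n := w 1 * Real.cos β + nabla ν ((1 / 2 : ℝ) • w - k) 0 1 * Real.sin β with hn
  set s := -(n / m) with hs
  have hsm : s * m + n = 0 := by rw [hs]; field_simp; ring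
  have hr := (hru.smul s).add hrw
  have e : s • (1 / 2 : ℝ) • u + ((1 / 2 : ℝ) • w - k) = (1 / 2 : ℝ) • (s • u + w) - k := by
    module
  have hfS : Represents μ ν (s • u + w) ((1 / 2 : ℝ) • (s • u + w) - k) (s * Real.sin α + 0)
      (s * Real.cos α + 0) := by
    rwa [← e]
  have hf : StrongOp μ ν α β (s • u + w) ((1 / 2 : ℝ) • (s • u + w) - k) := by
    refine ⟨sub_mem (Submodule.smul_mem _ _ hfS.mem_CSpace) k.2.1, _, _, hfS, ?_, ?_⟩
    · rw [nabla_zero hν0, ContinuousMap.add_apply, ContinuousMap.smul_apply, hu0, hw0, smul_eq_mul]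
      ring
    · rw [← e, nabla_add, nabla_smul, ContinuousMap.add_apply, ContinuousMap.smul_apply,
        smul_eq_mul]
      linear_combination hsm
  have hfm := mem_CGamma_of_strongOp hf
  exact ⟨((⟨s • u + w, hfm⟩ : CGamma μ ν α β),
    (1 / 2 : ℝ) • (⟨s • u + w, hfm⟩ : CGamma μ ν α β) - k),
    hf, by simp⟩

end Dissipative

/-! ### Approximation by functions that are piecewise affine in `F_μ` -/

section Splines

variable {μ ν : Measure I} [IsProbabilityMeasure μ] [NullSingletonClass μ]

/-- The functions that are piecewise affine in `F_μ`, with finitely many nodes, all in `supp ν`. -/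
def splineSpace (μ ν : Measure I) [IsProbabilityMeasure μ] [NullSingletonClass μ] :
    Submodule ℝ C(I, ℝ) :=
  Submodule.span ℝ ({1, cdfMap μ} ∪ kernel μ '' ν.support)

theorem splineSpace_le_CSpace : splineSpace μ ν ≤ CSpace μ ν := by
  refine Submodule.span_le.2 ?_
  rintro _ ((rfl | rfl) | ⟨y, hy, rfl⟩)
  exacts [one_mem_CSpace, cdfMap_mem_CSpace, kernel_mem_CSpace hy]

theorem kernel_zero (μ : Measure I) [IsProbabilityMeasure μ] [NullSingletonClass μ] :
    kernel μ 0 = cdfMap μ := by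
  ext x
  simp [F_zero, F_nonneg]

theorem kernel_eq_zero_of_F_eq_one {q : I} (hq : F μ q = 1) : kernel μ q = 0 := by
  ext x
  simp [hq, F_le_one]

theorem kernel_eq_cdfMap_of_F_eq_zero {p : I} (hp : F μ p = 0) : kernel μ p = cdfMap μ := by
  ext x
  simp [hp, F_nonneg]

theorem kernel_mem_splineSpace {y : I} (hy : y ∈ ν.support ∪ {0, 1}) :
    kernel μ y ∈ splineSpace μ ν := by
  rcases hy with hy | rfl | rfl
  · exact Submodule.subset_span (Or.inr ⟨y, hy, rfl⟩)
  · rw [kernel_zero]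
    exact Submodule.subset_span (Or.inl (Or.inr rfl))
  · rw [kernel_eq_zero_of_F_eq_one (F_one μ)]
    exact zero_mem _

/-- `k` is approximated up to `ε` on the part of `supp ν ∪ {0, 1}` to the left of `y` by a spline
that interpolates `k` at `0` and at `y` and is constant to the right of `y`. -/
def ApproxUpTo (μ ν : Measure I) [IsProbabilityMeasure μ] [NullSingletonClass μ] (k : C(I, ℝ))
    (ε : ℝ) (y : I) : Prop :=
  ∃ u ∈ splineSpace μ ν, (∀ x ∈ ν.support ∪ {0, 1}, x ≤ y → |u x - k x| ≤ ε) ∧ u 0 = k 0 ∧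
    ∀ x, y ≤ x → u x = k y

theorem ApproxUpTo.extend {k : C(I, ℝ)} (hk : ∀ x y, F μ x = F μ y → k x = k y) {ε : ℝ}
    (hε : 0 ≤ ε) {y z : I} (hy : y ∈ ν.support ∪ {0, 1}) (hz : z ∈ ν.support ∪ {0, 1})
    (hyz : y ≤ z) (h : ApproxUpTo μ ν k ε y)
    (hosc : ∀ x ∈ ν.support ∪ {0, 1}, x ∈ Ioo y z → |k y - k x| ≤ ε ∧ |k z - k x| ≤ ε) :
    ApproxUpTo μ ν k ε z := by
  obtain ⟨u, hu, hua, hu0, hur⟩ := h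
  -- if `F μ y = F μ z` then `k y = k z`, and division by zero gives the right slope `c = 0`
  set c := (k z - k y) / (F μ z - F μ y) with hc
  have hcz : c * (F μ z - F μ y) = k z - k y := by
    rcases eq_or_ne (F μ z) (F μ y) with h | h
    · rw [h, sub_self, mul_zero, hk z y h, sub_self]
    · exact div_mul_cancel₀ _ (sub_ne_zero.2 h)
  have hle : ∀ x, x ≤ y → (u + c • (kernel μ y - kernel μ z)) x = u x := by
    intro x hx
    simp [F_mono μ hx, F_mono μ (hx.trans hyz)]
  have hge : ∀ x, z ≤ x → (u + c • (kernel μ y - kernel μ z)) x = k z := by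
    intro x hx
    have h1 := F_mono μ hx
    have h2 := F_mono μ hyz
    simp only [ContinuousMap.add_apply, ContinuousMap.smul_apply, ContinuousMap.sub_apply,
      kernel_apply, smul_eq_mul, max_eq_left (sub_nonneg.2 h1),
      max_eq_left (sub_nonneg.2 (h2.trans h1)), hur x (hyz.trans hx)]
    linear_combination hcz
  refine ⟨u + c • (kernel μ y - kernel μ z), add_mem hu (Submodule.smul_mem _ _
    (sub_mem (kernel_mem_splineSpace hy) (kernel_mem_splineSpace hz))), ?_, ?_, hge⟩
  · intro x hx hxz
    rcases le_or_gt x y with hxy | hxy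
    · rw [hle x hxy]
      exact hua x hx hxy
    rcases hxz.eq_or_lt with rfl | hxz
    · rw [hge x le_rfl, sub_self, abs_zero]
      exact hε
    -- between the nodes the new spline is a convex combination of `k y` and `k z`
    obtain ⟨h1, h2⟩ := hosc x hx ⟨hxy, hxz⟩
    have hF1 := F_mono μ hxy.le
    have hF2 := F_mono μ hxz.le
    have hv : (u + c • (kernel μ y - kernel μ z)) x = k y + c * (F μ x - F μ y) := by
      simp [hur x hxy.le, hF1, hF2]
    rw [hv]
    rw [abs_le] at h1 h2 ⊢
    rcases le_total 0 c with hc0 | hc0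
    · have e1 := mul_nonneg hc0 (sub_nonneg.2 hF1)
      have e2 := mul_nonneg hc0 (sub_nonneg.2 hF2)
      constructor <;> nlinarith
    · have e1 := mul_nonneg_of_nonpos_of_nonpos hc0 (sub_nonpos.2 hF1)
      have e2 := mul_nonneg_of_nonpos_of_nonpos hc0 (sub_nonpos.2 hF2)
      constructor <;> nlinarith
  · rw [hle 0 unitInterval.nonneg', hu0]

/-- A continuous function of `F_μ` is uniformly approximated on `supp ν` by splines with the same
values at `0` and `1`. The points up to which this is possible have a largest limit point `t`; by
continuity of `k` the approximation reaches `t`, and from `t < 1` it could be continued, either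
to nearby points of `supp ν` or across a gap. -/
theorem exists_spline_approx {k : C(I, ℝ)} (hk : ∀ x y, F μ x = F μ y → k x = k y) {ε : ℝ}
    (hε : 0 < ε) : ∃ u ∈ splineSpace μ ν, (∀ x ∈ ν.support ∪ {0, 1}, |u x - k x| ≤ ε) ∧
      u 0 = k 0 ∧ u 1 = k 1 := by
  suffices h : ApproxUpTo μ ν k ε 1 by
    obtain ⟨u, hu, hua, hu0, hur⟩ := h
    exact ⟨u, hu, fun x hx => hua x hx unitInterval.le_one', hu0, hur 1 le_rfl⟩
  set Z : Set I := ν.support ∪ {0, 1} with hZ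
  have hZc : IsClosed Z := Measure.isClosed_support.union (toFinite _).isClosed
  set T : Set I := {y | y ∈ Z ∧ ApproxUpTo μ ν k ε y} with hT
  have h0T : (0 : I) ∈ T := by
    refine ⟨Or.inr (Or.inl rfl), k 0 • 1,
      Submodule.smul_mem _ _ (Submodule.subset_span (Or.inl (Or.inl rfl))), ?_, by simp, by simp⟩
    intro x _ hx
    have : x = 0 := le_antisymm hx unitInterval.nonneg'
    simp [this, hε.le]
  obtain ⟨t, htT, ht⟩ := (isClosed_closure (s := T)).isCompact.exists_isGreatest
    ⟨0, subset_closure h0T⟩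
  have hTZ : closure T ⊆ Z := closure_minimal (fun y hy => hy.1) hZc
  obtain ⟨δ, hδ, hkδ⟩ := Metric.continuous_iff.1 k.continuous t (ε / 2) (half_pos hε)
  simp only [Real.dist_eq] at hkδ
  have htT' : t ∈ T := by
    obtain ⟨y, hyT, hyt⟩ := Metric.mem_closure_iff.1 htT δ hδ
    rw [dist_comm] at hyt
    refine ⟨hTZ htT, hyT.2.extend hk hε.le hyT.1 (hTZ htT) (ht (subset_closure hyT)) ?_⟩
    intro x _ hx
    have h1 := abs_lt.1 (hkδ y hyt)
    have h2 := abs_lt.1 (hkδ x (lt_of_le_of_lt (Real.dist_right_le_of_mem_uIcc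
      (Icc_subset_uIcc ⟨Subtype.coe_le_coe.2 hx.1.le, Subtype.coe_le_coe.2 hx.2.le⟩)) hyt))
    constructor <;> rw [abs_le] <;> constructor <;> linarith
  rcases (show t ≤ 1 from unitInterval.le_one').eq_or_lt with rfl | ht1
  · exact htT'.2
  exfalso
  have hnext : ∀ z, t < z → z ∈ Z →
      (∀ x ∈ Z, x ∈ Ioo t z → |k t - k x| ≤ ε ∧ |k z - k x| ≤ ε) → False := fun z htz hz h =>
    (ht (subset_closure ⟨hz, htT'.2.extend hk hε.le htT'.1 hz htz.le h⟩)).not_gt htz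
  by_cases hz : ∃ z ∈ Z, t < z ∧ dist z t < δ
  · obtain ⟨z, hz, htz, hzδ⟩ := hz
    refine hnext z htz hz fun x _ hx => ?_
    have h1 := abs_lt.1 (hkδ z hzδ)
    have h2 := abs_lt.1 (hkδ x (by
      rw [dist_comm]
      refine lt_of_le_of_lt (Real.dist_left_le_of_mem_uIcc
        (Icc_subset_uIcc ⟨Subtype.coe_le_coe.2 hx.1.le, Subtype.coe_le_coe.2 hx.2.le⟩)) ?_
      rwa [dist_comm] at hzδ))
    constructor <;> rw [abs_le] <;> constructor <;> linarith
  · push Not at hz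
    have hne : (Z ∩ (Ici t ∩ {x | δ ≤ dist x t})).Nonempty :=
      ⟨1, Or.inr (Or.inr rfl), ht1.le, hz 1 (Or.inr (Or.inr rfl)) ht1⟩
    obtain ⟨z, ⟨hzZ, hzt, hzδ⟩, hzm⟩ := (hZc.inter (isClosed_Ici.inter
      (isClosed_le continuous_const (continuous_id.dist continuous_const)))).isCompact.exists_isLeast
        hne
    have htz : t < z := lt_of_le_of_ne hzt fun h => by
      rw [mem_ofPred_eq, h, id_eq, dist_self] at hzδ
      exact hδ.not_ge hzδ
    exact hnext z htz hzZ fun x hx hxz =>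
      absurd hxz.2 (hzm ⟨hx, hxz.1.le, hz x hx hxz.1⟩).not_gt

theorem CSpace_affine_on_gap {v : C(I, ℝ)} (hv : v ∈ CSpace μ ν) {c d : I} (hcd : c < d)
    (hgap : Ioo c d ⊆ ν.supportᶜ) : ∃ a b : ℝ, ∀ x ∈ Icc c d, v x = a * F μ x + b := by
  obtain ⟨x₀, hx₀⟩ := nonempty_Ioo.2 hcd
  obtain ⟨a, b, h⟩ := hv x₀ (hgap hx₀)
  have hsub := isPreconnected_Ioo.subset_connectedComponentIn hx₀ hgap
  have h1 : EqOn v (fun x => a * F μ x + b) (Ioo c d) := fun x hx => h x (hsub hx)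
  have h2 := h1.closure v.continuous (((continuous_F μ).const_mul a).add continuous_const)
  rw [closure_Ioo hcd.ne] at h2
  exact ⟨a, b, h2⟩

/-- Elements of `C_{ν,μ}` are functions of `F_μ`: the gaps of `supp μ` are gaps of `supp ν`. -/
theorem eq_of_F_eq (hsupp : ν.support ⊆ μ.support) {v : C(I, ℝ)} (hv : v ∈ CSpace μ ν) {x y : I}
    (hxy : F μ x = F μ y) : v x = v y := by
  wlog h : x < y generalizing x y
  · rcases (not_lt.1 h).eq_or_lt with rfl | h'
    · rfl
    · exact (this hxy.symm h').symm
  have h0 : μ (Ioo x y) = 0 := by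
    refine measure_mono_null (t := Iic y \ Iic x) (fun z hz => ⟨hz.2.le, hz.1.not_ge⟩) ?_
    rw [← measureReal_eq_zero_iff, measureReal_sdiff (Iic_subset_Iic.2 h.le) measurableSet_Iic]
    exact sub_eq_zero.2 hxy.symm
  obtain ⟨a, b, hab⟩ := CSpace_affine_on_gap hv h fun z hz hzν =>
    ((Measure.mem_support_iff_forall z).1 (hsupp hzν) _ (Ioo_mem_nhds hz.1 hz.2)).ne' h0
  rw [hab x (left_mem_Icc.2 h.le), hab y (right_mem_Icc.2 h.le), hxy]

theorem CSpace_abs_le {v : C(I, ℝ)} (hv : v ∈ CSpace μ ν) {ε : ℝ}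
    (h : ∀ x ∈ ν.support ∪ {0, 1}, |v x| ≤ ε) (x : I) : |v x| ≤ ε := by
  set Z : Set I := ν.support ∪ {0, 1} with hZ
  by_cases hx : x ∈ Z
  · exact h x hx
  have hZc : IsClosed Z := Measure.isClosed_support.union (toFinite _).isClosed
  obtain ⟨c, ⟨hcZ, hcx⟩, hc⟩ := (hZc.inter (isClosed_Iic (a := x))).isCompact.exists_isGreatest
    ⟨0, Or.inr (Or.inl rfl), unitInterval.nonneg'⟩
  obtain ⟨d, ⟨hdZ, hdx⟩, hd⟩ := (hZc.inter (isClosed_Ici (a := x))).isCompact.exists_isLeast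
    ⟨1, Or.inr (Or.inr rfl), unitInterval.le_one'⟩
  have hcx' : c < x := lt_of_le_of_ne hcx fun h => hx (h ▸ hcZ)
  have hdx' : x < d := lt_of_le_of_ne hdx fun h => hx (h ▸ hdZ)
  obtain ⟨a, b, hab⟩ := CSpace_affine_on_gap hv (hcx'.trans hdx') fun z hz hzν => by
    rcases le_total z x with hzx | hzx
    · exact (hc ⟨Or.inl hzν, hzx⟩).not_gt hz.1
    · exact (hd ⟨Or.inl hzν, hzx⟩).not_gt hz.2
  have h1 := abs_le.1 (h c hcZ)
  have h2 := abs_le.1 (h d hdZ)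
  rw [hab c ⟨le_rfl, (hcx'.trans hdx').le⟩] at h1
  rw [hab d ⟨(hcx'.trans hdx').le, le_rfl⟩] at h2
  rw [hab x ⟨hcx'.le, hdx'.le⟩, abs_le]
  have hF1 := F_mono μ hcx'.le
  have hF2 := F_mono μ hdx'.le
  rcases le_total 0 a with ha | ha
  · constructor <;> nlinarith
  · constructor <;> nlinarith

theorem CSpace_le_topologicalClosure_splineSpace (hsupp : ν.support ⊆ μ.support) :
    CSpace μ ν ≤ (splineSpace μ ν).topologicalClosure := by
  intro f hf
  refine Metric.mem_closure_iff.2 fun ε hε => ?_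
  obtain ⟨u, hu, huf, -, -⟩ := exists_spline_approx (ν := ν)
    (fun x y hxy => eq_of_F_eq hsupp hf hxy) (half_pos hε)
  refine ⟨u, hu, ?_⟩
  rw [dist_comm, dist_eq_norm]
  refine lt_of_le_of_lt ((ContinuousMap.norm_le _ (half_pos hε).le).2 fun x => ?_) (half_lt_self hε)
  exact CSpace_abs_le (sub_mem (splineSpace_le_CSpace hu) hf) huf x

/-- A continuous function of `F_μ` that is orthogonal to `C^γ_{ν,μ}` in `L²(ν)` vanishes on
`supp ν`, as it is itself approximated on `supp ν` by elements of `C^γ_{ν,μ}`. -/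
theorem eq_zero_on_support_of_orthogonal [IsProbabilityMeasure ν] {k : C(I, ℝ)} {α β : ℝ}
    (hk : ∀ x y, F μ x = F μ y → k x = k y) (hα : α = 0 → k 0 = 0) (hβ : β = 0 → k 1 = 0)
    (horth : ∀ g ∈ CGamma μ ν α β, ∫ y, k y * g y ∂ν = 0) {y : I} (hy : y ∈ ν.support) :
    k y = 0 := by
  have hint : ∀ u : C(I, ℝ), Integrable (fun y => k y * u y) ν := fun u =>
    integrable_continuousMap (k * u)
  have h1 : ∀ ε : ℝ, 0 < ε → ∫ y, k y * k y ∂ν ≤ ε * ‖k‖ := by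
    intro ε hε
    obtain ⟨u, hu, huk, hu0, hu1⟩ := exists_spline_approx (ν := ν) hk hε
    have hug : u ∈ CGamma μ ν α β :=
      ⟨splineSpace_le_CSpace hu, fun h => hu0.trans (hα h), fun h => hu1.trans (hβ h)⟩
    have h2 : ∫ y, k y * k y ∂ν = ∫ y, k y * (k y - u y) ∂ν := by
      simp only [mul_sub]
      rw [integral_sub (hint k) (hint u), horth u hug, sub_zero]
    rw [h2]
    refine (Real.le_norm_self _).trans ((norm_integral_le_of_norm_le_const (C := ε * ‖k‖) ?_).trans
      (by simp))
    have : ∀ᵐ y ∂ν, y ∈ ν.support := Measure.support_mem_ae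
    filter_upwards [this] with y hy
    rw [norm_mul, mul_comm, norm_sub_rev]
    exact mul_le_mul (huk y (Or.inl hy)) (k.norm_coe_le_norm y) (norm_nonneg _) hε.le
  have h2 : ∫ y, k y * k y ∂ν = 0 := by
    refine le_antisymm (le_of_forall_pos_le_add fun ε hε => ?_)
      (integral_nonneg fun y => mul_self_nonneg _)
    refine (h1 (ε / (‖k‖ + 1)) (by positivity)).trans ?_
    rw [zero_add, div_mul_eq_mul_div, div_le_iff₀ (by positivity)]
    nlinarith [norm_nonneg k]
  rw [integral_eq_zero_iff_of_nonneg (fun y => mul_self_nonneg _) (hint k)] at h2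
  by_contra hy0
  have hpos := (Measure.mem_support_iff_forall y).1 hy _
    ((isOpen_ne_fun k.continuous continuous_const).mem_nhds hy0)
  refine hpos.ne' (measure_mono_null (fun z hz => ?_) (ae_iff.1 h2))
  simpa using hz

end Splines

/-! ### Density of the domain -/

section Density

theorem mem_topologicalClosure_of_forall_dual {E : Type*} [NormedAddCommGroup E] [NormedSpace ℝ E]
    {p : Submodule ℝ E} {x : E} (h : ∀ L : E →L[ℝ] ℝ, (∀ y ∈ p, L y = 0) → L x = 0) :
    x ∈ p.topologicalClosure := by
  by_contra hx
  obtain ⟨L, u, hxu, hu⟩ := geometric_hahn_banach_point_closed p.topologicalClosure.convex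
    p.isClosed_topologicalClosure hx
  have hu0 : u < 0 := by simpa using hu 0 (zero_mem _)
  have hL : ∀ y ∈ p, L y = 0 := by
    intro y hy
    by_contra hy0
    have := hu ((u / L y) • y) (Submodule.smul_mem _ _ (p.le_topologicalClosure hy))
    rw [map_smul, smul_eq_mul, div_mul_cancel₀ _ hy0] at this
    exact lt_irrefl _ this
  linarith [h L hL]

theorem F_eq_one_of_isGreatest {μ : Measure I} [IsProbabilityMeasure μ] {q : I}
    (hq : IsGreatest μ.support q) : F μ q = 1 := by
  have h : (Iic q)ᶜ ⊆ μ.supportᶜ := fun y hy hys => hy (hq.2 hys)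
  have h0 : μ.real (Iic q)ᶜ = 0 :=
    (measureReal_eq_zero_iff).2 (measure_mono_null h Measure.measure_compl_support)
  rw [probReal_compl_eq_one_sub measurableSet_Iic] at h0
  rw [F]
  linarith

variable {μ ν : Measure I} [IsProbabilityMeasure μ] [IsProbabilityMeasure ν] [NullSingletonClass μ]
  {α β : ℝ}

theorem F_eq_zero_of_isLeast {p : I} (hp : IsLeast μ.support p) : F μ p = 0 := by
  have h : Iic p ⊆ {p} ∪ μ.supportᶜ := fun y hy => by
    by_cases hyp : y = p
    · exact Or.inl hyp
    · exact Or.inr fun hys => hyp (le_antisymm hy (hp.2 hys))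
  rw [F, measureReal_eq_zero_iff]
  exact measure_mono_null h (measure_union_null (measure_singleton p) Measure.measure_compl_support)

/-- The functions `s (sin α + cos α F_μ) + ∫ g(y) (F_μ(·) - F_μ(y))⁺ dν(y)` satisfy the boundary
condition at `0`. A functional that vanishes on those that satisfy the condition at `1` too is a
multiple of the functional defining that condition. -/
theorem exists_lagrange_multiplier (hν0 : ν {0} = 0) {L : C(I, ℝ) →L[ℝ] ℝ}
    (hL : ∀ f g : C(I, ℝ), g ∈ CGamma μ ν α β → StrongOp μ ν α β f g → L f = 0) :
    ∃ θ : ℝ, Real.sin α * L 1 + Real.cos α * L (cdfMap μ)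
        = θ * (Real.cos β * (Real.sin α + Real.cos α) + Real.sin β * Real.cos α) ∧
      ∀ g ∈ CGamma μ ν α β, L (potential μ ν g)
        = θ * (Real.cos β * potential μ ν g 1 + Real.sin β * ∫ y, g y ∂ν) := by
  let Φ : (ℝ × CGamma μ ν α β) →ₗ[ℝ] ℝ :=
    { toFun := fun p => p.1 * (Real.sin α * L 1 + Real.cos α * L (cdfMap μ))
        + L (potential μ ν (p.2 : C(I, ℝ)))
      map_add' := fun p q => by
        simp only [Prod.fst_add, Prod.snd_add, Submodule.coe_add, map_add]; ring
      map_smul' := fun c p => by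
        simp only [Prod.smul_fst, Prod.smul_snd, Submodule.coe_smul, map_smul, smul_eq_mul,
          RingHom.id_apply]; ring }
  let Ψ : (ℝ × CGamma μ ν α β) →ₗ[ℝ] ℝ :=
    { toFun := fun p =>
        p.1 * (Real.cos β * (Real.sin α + Real.cos α) + Real.sin β * Real.cos α)
        + (Real.cos β * potential μ ν (p.2 : C(I, ℝ)) 1
          + Real.sin β * ∫ y, (p.2 : C(I, ℝ)) y ∂ν)
      map_add' := fun p q => by
        simp only [Prod.fst_add, Prod.snd_add, Submodule.coe_add, map_add,
          ContinuousMap.add_apply]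
        rw [integral_add (integrable_continuousMap _) (integrable_continuousMap _)]
        ring
      map_smul' := fun c p => by
        simp only [Prod.smul_fst, Prod.smul_snd, Submodule.coe_smul, map_smul, smul_eq_mul,
          ContinuousMap.smul_apply, RingHom.id_apply, integral_const_mul]
        ring }
  have hker : Ψ.ker ≤ Φ.ker := by
    rintro ⟨s, g⟩ hsg
    simp only [LinearMap.mem_ker, Ψ, LinearMap.coe_mk, AddHom.coe_mk] at hsg
    have hr : Represents μ ν (s • (Real.sin α • 1 + Real.cos α • cdfMap μ)
        + potential μ ν (g : C(I, ℝ))) (g : C(I, ℝ)) (s * Real.sin α) (s * Real.cos α) := by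
      rw [represents_iff]
      module
    have h0 := hr.apply_zero
    have h := hL _ (g : C(I, ℝ)) g.2 ⟨g.2.1, _, _, hr, by rw [h0, nabla_zero hν0]; ring, by
      rw [nabla, setIntegral_Iic_one]
      simp only [ContinuousMap.add_apply, ContinuousMap.smul_apply, ContinuousMap.one_apply,
        cdfMap_apply, F_one, smul_eq_mul]
      linear_combination hsg⟩
    simp only [map_add, map_smul, smul_eq_mul] at h
    simpa [Φ] using h
  have hspan := mem_span_of_iInf_ker_le_ker (L := fun _ : Unit => Ψ) (K := Φ) (by simpa using hker)
  rw [range_const] at hspan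
  obtain ⟨θ, hθ⟩ := Submodule.mem_span_singleton.1 hspan
  refine ⟨θ, ?_, fun g hg => ?_⟩
  · simpa [Φ, Ψ] using (LinearMap.congr_fun hθ (1, 0)).symm
  · simpa [Φ, Ψ] using (LinearMap.congr_fun hθ (0, ⟨g, hg⟩)).symm

/-- A functional that annihilates the domain agrees on `C_{ν,μ}` with a combination of the
evaluations at `0` and `1`, where the former occurs only if `α = 0`, and the latter only if
`β = 0`. This is where the conditions on the end points of the supports are needed. -/
theorem dual_eq_zero_of_strongOp (hsupp : ν.support ⊆ μ.support) (hν0 : ν {0} = 0)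
    (hα : α ∈ Icc 0 (Real.pi / 2)) (hβ : β ∈ Icc 0 (Real.pi / 2))
    (hmin : α ≠ 0 → ∃ p, IsLeast μ.support p ∧ IsLeast ν.support p)
    (hmax : β ≠ 0 → ∃ q, IsGreatest μ.support q ∧ IsGreatest ν.support q) {L : C(I, ℝ) →L[ℝ] ℝ}
    (hL : ∀ f g : C(I, ℝ), g ∈ CGamma μ ν α β → StrongOp μ ν α β f g → L f = 0) {f : C(I, ℝ)}
    (hf : f ∈ CGamma μ ν α β) : L f = 0 := by
  obtain ⟨θ, hθ1, hθ⟩ := exists_lagrange_multiplier hν0 hL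
  have hα0 : α ≠ 0 → 0 < Real.sin α := fun h =>
    Real.sin_pos_of_pos_of_lt_pi (lt_of_le_of_ne hα.1 h.symm) (by linarith [hα.2, Real.pi_pos])
  have hβ0 : β ≠ 0 → 0 < Real.sin β := fun h =>
    Real.sin_pos_of_pos_of_lt_pi (lt_of_le_of_ne hβ.1 h.symm) (by linarith [hβ.2, Real.pi_pos])
  let k : C(I, ℝ) := ⟨fun y => L (kernel μ y) - θ * (Real.cos β * kernel μ y 1 + Real.sin β), by
    fun_prop⟩
  have hk : ∀ y, k y = L (kernel μ y) - θ * (Real.cos β * kernel μ y 1 + Real.sin β) := fun _ => rfl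
  have hkF : ∀ x y, F μ x = F μ y → k x = k y := by
    intro x y hxy
    have : kernel μ x = kernel μ y := by
      ext z
      rw [kernel_apply, kernel_apply, hxy]
    rw [hk, hk, this]
  have horth : ∀ g ∈ CGamma μ ν α β, ∫ y, k y * g y ∂ν = 0 := by
    intro g hg
    have h := hθ g hg
    rw [clm_potential L, potential_apply] at h
    have i1 : Integrable (fun y => L (kernel μ y) * g y) ν :=
      integrable_continuousMap ⟨fun y => L (kernel μ y) * g y, by fun_prop⟩
    have i2 : Integrable (fun y => kernel μ y 1 * g y) ν :=
      integrable_continuousMap ⟨fun y => kernel μ y 1 * g y, by fun_prop⟩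
    have i3 : Integrable (fun y => g y) ν := integrable_continuousMap g
    have e : ∀ y, k y * g y = L (kernel μ y) * g y
        - (θ * Real.cos β * (kernel μ y 1 * g y) + θ * Real.sin β * g y) := fun y => by
      rw [hk]; ring
    simp only [e]
    have i23 : Integrable (fun y => θ * Real.cos β * (kernel μ y 1 * g y)
        + θ * Real.sin β * g y) ν := (i2.const_mul _).add (i3.const_mul _)
    rw [integral_sub i1 i23, integral_add (i2.const_mul _) (i3.const_mul _), integral_const_mul,
      integral_const_mul, h]
    simp only [kernel_apply]
    ring
  have hk0 : α = 0 → k 0 = 0 := by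
    rintro rfl
    rw [hk, kernel_zero, cdfMap_apply, F_one]
    simp only [Real.sin_zero, Real.cos_zero] at hθ1
    linear_combination hθ1
  have hk1 : β = 0 → k 1 = 0 := by
    rintro rfl
    rw [hk, kernel_eq_zero_of_F_eq_one (F_one μ)]
    simp
  have hks : ∀ y ∈ ν.support, L (kernel μ y) = θ * (Real.cos β * kernel μ y 1 + Real.sin β) :=
    fun y hy => sub_eq_zero.1 (eq_zero_on_support_of_orthogonal hkF hk0 hk1 horth hy)
  -- at the right end point of both supports the kernel vanishes
  have hθβ : β ≠ 0 → θ = 0 := by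
    intro h
    obtain ⟨q, hqμ, hqν⟩ := hmax h
    have := hks q hqν.1
    rw [kernel_eq_zero_of_F_eq_one (F_eq_one_of_isGreatest hqμ)] at this
    simpa [(hβ0 h).ne'] using this
  have hθsin : θ * Real.sin β = 0 := by
    rcases eq_or_ne β 0 with rfl | h
    · simp
    · simp [hθβ h]
  have hLF : L (cdfMap μ) = θ * Real.cos β := by
    rcases eq_or_ne α 0 with rfl | h
    · simp only [Real.sin_zero, Real.cos_zero] at hθ1
      linear_combination hθ1 + hθsin
    · obtain ⟨p, hpμ, hpν⟩ := hmin h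
      have := hks p hpν.1
      rw [kernel_eq_cdfMap_of_F_eq_zero (F_eq_zero_of_isLeast hpμ), cdfMap_apply, F_one] at this
      linear_combination this + hθsin
  have hτ : α ≠ 0 → L 1 - θ * Real.cos β = 0 := by
    intro h
    have : Real.sin α * (L 1 - θ * Real.cos β) = 0 := by
      linear_combination hθ1 - Real.cos α * hLF + Real.cos α * hθsin
    exact (mul_eq_zero.1 this).resolve_left (hα0 h).ne'
  set L' : C(I, ℝ) →L[ℝ] ℝ := L - (θ * Real.cos β) • ContinuousMap.evalCLM ℝ 1
    - (L 1 - θ * Real.cos β) • ContinuousMap.evalCLM ℝ 0 with hL'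
  have hL'f : ∀ u, L' u = L u - θ * Real.cos β * u 1 - (L 1 - θ * Real.cos β) * u 0 := fun _ => rfl
  have hspline : splineSpace μ ν ≤ L'.ker := by
    refine Submodule.span_le.2 ?_
    rintro _ ((rfl | rfl) | ⟨y, hy, rfl⟩)
    · rw [SetLike.mem_coe, LinearMap.mem_ker]
      change L' 1 = 0
      rw [hL'f]
      simp
    · rw [SetLike.mem_coe, LinearMap.mem_ker]
      change L' (cdfMap μ) = 0
      rw [hL'f, hLF, cdfMap_apply, cdfMap_apply, F_one, F_zero]
      ring
    · rw [SetLike.mem_coe, LinearMap.mem_ker]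
      change L' (kernel μ y) = 0
      have h0 : kernel μ y 0 = 0 := by simp [F_zero, F_nonneg]
      rw [hL'f, hks y hy, h0]
      linear_combination hθsin
  have hf' : f ∈ L'.ker := Submodule.topologicalClosure_minimal _ hspline L'.isClosed_ker
    (CSpace_le_topologicalClosure_splineSpace hsupp hf.1)
  have h : L f - θ * Real.cos β * f 1 - (L 1 - θ * Real.cos β) * f 0 = 0 := hf'
  have h1 : θ * Real.cos β * f 1 = 0 := by
    rcases eq_or_ne β 0 with hb | hb
    · rw [hf.2.2 hb, mul_zero]
    · rw [hθβ hb, zero_mul, zero_mul]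
  have h2 : (L 1 - θ * Real.cos β) * f 0 = 0 := by
    rcases eq_or_ne α 0 with ha | ha
    · rw [hf.2.1 ha, mul_zero]
    · rw [hτ ha, zero_mul]
  linear_combination h + h1 + h2

theorem dense_domain_laplaceGraph (hsupp : ν.support ⊆ μ.support) (hν0 : ν {0} = 0)
    (hα : α ∈ Icc 0 (Real.pi / 2)) (hβ : β ∈ Icc 0 (Real.pi / 2))
    (hmin : α ≠ 0 → ∃ p, IsLeast μ.support p ∧ IsLeast ν.support p)
    (hmax : β ≠ 0 → ∃ q, IsGreatest μ.support q ∧ IsGreatest ν.support q) :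
    Dense (Prod.fst '' (laplaceGraph μ ν α β : Set (CGamma μ ν α β × CGamma μ ν α β))) := by
  intro f
  set D : Submodule ℝ C(I, ℝ) := (laplaceGraph μ ν α β).map
    ((CGamma μ ν α β).subtype ∘ₗ LinearMap.fst ℝ _ _) with hD
  have hf : (f : C(I, ℝ)) ∈ D.topologicalClosure := by
    refine mem_topologicalClosure_of_forall_dual fun L hL => ?_
    refine dual_eq_zero_of_strongOp hsupp hν0 hα hβ hmin hmax (fun u g hg hug => ?_) f.2
    exact hL u ⟨(⟨u, mem_CGamma_of_strongOp hug⟩, ⟨g, hg⟩), hug, rfl⟩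
  rw [closure_subtype, image_image]
  exact hf

end Density

end KreinFeller

theorem mainTheorem7 (μ ν : Measure I) [IsProbabilityMeasure μ] [IsProbabilityMeasure ν]
    [NullSingletonClass μ] (hsupp : ν.support ⊆ μ.support) (hν : ν {0, 1} = 0)
    (α β : ℝ) (hα : α ∈ Icc 0 (Real.pi / 2)) (hβ : β ∈ Icc 0 (Real.pi / 2))
    (hmin : α ≠ 0 → ∃ p, IsLeast μ.support p ∧ IsLeast ν.support p)
    (hmax : β ≠ 0 → ∃ q, IsGreatest μ.support q ∧ IsGreatest ν.support q) :
    ∃ A : KreinFeller.CGamma μ ν α β →ₗ.[ℝ] KreinFeller.CGamma μ ν α β,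
      (∀ f g : KreinFeller.CGamma μ ν α β,
        (f, g) ∈ A.graph ↔ KreinFeller.StrongOp μ ν α β (f : C(I, ℝ)) (g : C(I, ℝ))) ∧
      ∃ T : ℝ≥0 → KreinFeller.CGamma μ ν α β →L[ℝ] KreinFeller.CGamma μ ν α β,
        KreinFeller.IsContractionSemigroup T ∧ KreinFeller.IsGenerator T A := by
  have hν0 : ν {0} = 0 := measure_mono_null (by simp) hν
  obtain ⟨A, hA, T, hT, hTA⟩ := KreinFeller.IsDissipative.exists_semigroup
    (E := KreinFeller.CGamma μ ν α β)
    (KreinFeller.isDissipative_laplaceGraph hα hβ hν0)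
    (KreinFeller.dense_domain_laplaceGraph hsupp hν0 hα hβ hmin hmax) one_half_pos
    (KreinFeller.hasFullRange_laplaceGraph hα hβ hν0)
  exact ⟨A, fun f g => by rw [hA]; rfl, T, hT, hTA⟩
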